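/- Let $K$ be a nonarchimedean local field of characteristic zero with ring of integers $\mathcal O_K$ and uniformizer $p$. Let $L$ be an unramified quadratic field extension of $K$, a ramified quadratic field extension of $K$, or $K\times K$ (the split case). Let $\mathcal O_L$ be the integral closure of $\mathcal O_K$ in $L$, write $\mathcal O_L=\mathcal O_K[\Delta]$, and for $n\ge 0$ put $\mathcal O_n=\mathcal O_K[p^n\Delta]$. When $L$ is a field, let $\pi$ be a uniformizer of $L$ and $f$ the inertia degree of $L/K$. The vertices of the Bruhat–Tits tree of $\mathrm{SL}(2,K)$ are the homothety classes (under $K^\times$) of $\mathcal O_K$-lattices in the two-dimensional $K$-space $L$; two distinct vertices are adjacent if they have representatives $M,N$ with $pM\subset N\subset M$. Let $d$ be the distance in this tree. Define the basin $\mathscr P$ to be $\{[\mathcal O_0]\}$ in the unramified case, $\{[\mathcal O_0],[\pi\mathcal O_0]\}$ in the ramified case, and $\{[(1,p^m)\mathcal O_0] : m\in\mathbb Z\}$ in the split case. Put $\mathscr R_0=\mathscr P_0=\mathscr P$ and, for $n\ge1$, let $\mathscr P_n$ be the set of vertices at distance at most $1$ from $\mathscr P_{n-1}$ and $\mathscr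 R_n=\mathscr P_n\setminus\mathscr P_{n-1}$. The type of $\alpha\in\mathcal O_L$ is $\varepsilon(\alpha)=\mathrm{val}_\pi(\alpha)$ if $L$ is a field, and $\varepsilon(\alpha)=(\mathrm{val}_p(\alpha_1),\mathrm{val}_p(\alpha_2))$ if $L=K\times K$ and $\alpha=(\alpha_1,\alpha_2)$. For a vertex $x$ let $\varepsilon(x)$ be the set of types $\varepsilon(\alpha)$ of the principal ideals $\alpha\mathcal O_n\subseteq\mathcal O_n$ that are lattices representing $x$. The contribution of a type is $c(\omega)=f\omega$ if $L$ is a field, and $c(\omega)=\omega_1+\omega_2$ if $L=K\times K$. Then for every $n\ge0$ and every vertex $x\in\mathscr R_n$ the set $\varepsilon(x)$ has a minimum $\omega(x)$ for the entrywise order (the source type at $x$), and $$d(x,\mathcal O_n)=c(\omega(x)).$$ -/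

import Mathlib

open scoped Pointwise ValuativeRel

universe u v

noncomputable section

namespace ImpactedBuilding

section Lattices

variable (K : Type u) [Field K] [ValuativeRel K]
variable (L : Type v) [CommRing L] [Algebra K L]

/-- The integral closure `O_L` of `O_K` in `L`. -/
abbrev maxOrder : Subalgebra 𝒪[K] L := integralClosure 𝒪[K] L

/-- The `O_K`-lattices in the `K`-vector space `L`: finitely generated `O_K`-submodules
that span `L` over `K`. -/
abbrev Lattice : Type v := {M : Submodule 𝒪[K] L // Submodule.IsLattice K M}

/-- Two lattices are homothetic when `M = c N` for some `c ∈ K^*`. -/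
def homothety : Setoid (Lattice K L) where
  r M N := ∃ c : Kˣ, M.1 = c • N.1
  iseqv :=
    { refl := fun M => ⟨1, (one_smul _ _).symm⟩
      symm := by
        rintro M N ⟨c, h⟩
        exact ⟨c⁻¹, by rw [h, inv_smul_smul]⟩
      trans := by
        rintro M N P ⟨c, h⟩ ⟨d, h'⟩
        exact ⟨c * d, by rw [h, h', mul_smul]⟩ }

/-- The vertices of the building of `SL(2, K)`, realized on the `K`-vector space `L`:
homothety classes of lattices. -/
def Vertex : Type v := Quotient (homothety K L)

variable {K L}

/-- The vertex represented by a lattice. -/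
def Lattice.toVertex (M : Lattice K L) : Vertex K L := Quotient.mk (homothety K L) M

/-- The vertex `x` is represented by the submodule `N` (which is then a lattice). -/
def Represents (N : Submodule 𝒪[K] L) (x : Vertex K L) : Prop :=
  ∃ M : Lattice K L, M.1 = N ∧ M.toVertex = x

/-- Multiplication of lattices by an invertible element of `L`. -/
def Lattice.mul (a : Lˣ) (M : Lattice K L) : Lattice K L :=
  ⟨M.1.map (LinearMap.mulLeft 𝒪[K] (a : L)), by
    refine ⟨M.2.fg.map _, ?_⟩
    have h := M.2.span_eq_top
    have e : ((M.1.map (LinearMap.mulLeft 𝒪[K] (a : L)) : Submodule 𝒪[K] L) : Set L)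
        = (LinearMap.mulLeft K (a : L)) '' (M.1 : Set L) := by
      ext y; simp
    rw [e, Submodule.span_image, h, Submodule.map_top, LinearMap.range_eq_top]
    intro y
    exact ⟨(a⁻¹ : Lˣ) * y, by simp⟩⟩

variable (K L)

/-- The Bruhat-Tits tree: two distinct vertices are adjacent when they have representatives with
`𝔪 M ⊂ N ⊂ M`, where `𝔪` is the maximal ideal of `O_K`. -/
def tree : SimpleGraph (Vertex K L) :=
  SimpleGraph.fromRel fun x y =>
    ∃ M N : Lattice K L, M.toVertex = x ∧ N.toVertex = y ∧ 𝓂[K] • M.1 < N.1 ∧ N.1 < M.1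

variable {K L}

/-- The filtration `P = P_0 ⊆ P_1 ⊆ ...` around a basin `P`. -/
def basinFiltration (P : Set (Vertex K L)) : ℕ → Set (Vertex K L)
  | 0 => P
  | n + 1 => {v | ∃ w ∈ basinFiltration P n, (tree K L).edist v w ≤ 1}

/-- The layers `R_0 = P` and `R_n = P_n \ P_{n-1}` around a basin `P`. -/
def layer (P : Set (Vertex K L)) : ℕ → Set (Vertex K L)
  | 0 => P
  | n + 1 => basinFiltration P (n + 1) \ basinFiltration P n

end Lattices

section Orders

variable {K : Type u} [Field K] [ValuativeRel K]
variable {L : Type v} [CommRing L] [Algebra K L]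

/-- `Δ` generates `O_L` over `O_K`. -/
def IsGenerator (K : Type u) [Field K] [ValuativeRel K] {L : Type v} [CommRing L] [Algebra K L]
    (Δ : L) : Prop :=
  Algebra.adjoin 𝒪[K] {Δ} = maxOrder K L

/-- The order `O_n = O_K[p^n Δ]`. -/
def order (p : 𝒪[K]) (Δ : L) (n : ℕ) : Subalgebra 𝒪[K] L := Algebra.adjoin 𝒪[K] {p ^ n • Δ}

theorem IsGenerator.isIntegral {Δ : L} (h : IsGenerator K Δ) : IsIntegral 𝒪[K] Δ := by
  have : Δ ∈ maxOrder K L := by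
    rw [← h]; exact Algebra.self_mem_adjoin_singleton _ _
  exact this

theorem order_le {Δ : L} (h : IsGenerator K Δ) (p : 𝒪[K]) (n : ℕ) :
    order p Δ n ≤ maxOrder K L := by
  refine Algebra.adjoin_le ?_
  rintro _ rfl
  exact h.isIntegral.smul _

theorem span_adjoin_singleton (y : L) :
    Submodule.span K ((Subalgebra.toSubmodule (Algebra.adjoin 𝒪[K] {y}) : Submodule 𝒪[K] L) : Set L)
      = Subalgebra.toSubmodule (Algebra.adjoin K {y}) := by
  refine le_antisymm (Submodule.span_le.2 ?_) ?_
  · have : Algebra.adjoin 𝒪[K] {y} ≤ (Algebra.adjoin K {y}).restrictScalars 𝒪[K] :=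
      Algebra.adjoin_le (Set.singleton_subset_iff.2 (Algebra.self_mem_adjoin_singleton K y))
    exact this
  · rw [Algebra.adjoin_eq_span]
    refine Submodule.span_mono ?_
    intro x hx
    obtain ⟨k, rfl⟩ := Submonoid.mem_closure_singleton.1 hx
    exact Subalgebra.pow_mem _ (Algebra.self_mem_adjoin_singleton 𝒪[K] y) k

theorem isLattice_order [Algebra.IsIntegral K L] {p : 𝒪[K]} (hp : Irreducible p) {Δ : L}
    (h : IsGenerator K Δ) (n : ℕ) :
    Submodule.IsLattice K (Subalgebra.toSubmodule (order p Δ n)) := by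
  refine ⟨(h.isIntegral.smul (p ^ n)).fg_adjoin_singleton, ?_⟩
  have hpK : ((p ^ n : 𝒪[K]) : K) ≠ 0 := by
    have : (p : K) ≠ 0 := by simpa using hp.ne_zero
    simpa using pow_ne_zero n this
  -- the `K`-subalgebra spanned by `O_n` contains `Δ`, hence `O_L`, hence everything
  have hΔ : Δ ∈ Algebra.adjoin K {p ^ n • Δ} := by
    have h1 : p ^ n • Δ ∈ Algebra.adjoin K {p ^ n • Δ} := Algebra.self_mem_adjoin_singleton _ _
    have h2 := Subalgebra.smul_mem _ h1 (((p ^ n : 𝒪[K]) : K)⁻¹)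
    have h3 : p ^ n • Δ = ((p ^ n : 𝒪[K]) : K) • Δ := rfl
    rwa [h3, inv_smul_smul₀ hpK] at h2
  have hO : maxOrder K L ≤ (Algebra.adjoin K {p ^ n • Δ}).restrictScalars 𝒪[K] := by
    rw [← (show Algebra.adjoin 𝒪[K] {Δ} = maxOrder K L from h)]
    refine Algebra.adjoin_le ?_
    rintro _ rfl
    exact hΔ
  have htop : Algebra.adjoin K {p ^ n • Δ} = ⊤ := by
    rw [eq_top_iff]
    rintro x -
    have hx : IsAlgebraic 𝒪[K] x :=
      (IsFractionRing.isAlgebraic_iff 𝒪[K] K L).2 (Algebra.IsIntegral.isIntegral x).isAlgebraic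
    obtain ⟨r, hr, hrx⟩ := hx.exists_integral_multiple
    have h1 : r • x ∈ Algebra.adjoin K {p ^ n • Δ} := hO hrx
    have h2 := Subalgebra.smul_mem _ h1 ((r : K)⁻¹)
    have h3 : r • x = (r : K) • x := rfl
    rwa [h3, inv_smul_smul₀ (by simpa using hr)] at h2
  rw [order, span_adjoin_singleton, htop]
  rfl

/-- The order `O_n` as a lattice in `L`. -/
def orderLattice [Algebra.IsIntegral K L] {p : 𝒪[K]} (hp : Irreducible p) {Δ : L}
    (h : IsGenerator K Δ) (n : ℕ) : Lattice K L :=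
  ⟨Subalgebra.toSubmodule (order p Δ n), isLattice_order hp h n⟩

/-- The lattice in `L` underlying an ideal of `O_n`. -/
def idealToSubmodule {p : 𝒪[K]} {Δ : L} {n : ℕ} (I : Ideal (order p Δ n)) : Submodule 𝒪[K] L :=
  (I.restrictScalars 𝒪[K]).map (order p Δ n).val.toLinearMap

/-- The set `ε(x)` of types of the principal ideals `I = α O_n` of `O_n` that represent the
vertex `x`, where `ε(I) = ε(α)`; here `ε` is the type function on `O_L`. (Ideals representing a
vertex have rank 2 over `O_K`.) -/
def typesAt {T : Type*} (ε : maxOrder K L → T) (p : 𝒪[K]) {Δ : L} (h : IsGenerator K Δ) (n : ℕ)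
    (x : Vertex K L) : Set T :=
  {ω | ∃ (I : Ideal (order p Δ n)) (α : order p Δ n), I = Ideal.span {α} ∧
    Represents (idealToSubmodule I) x ∧ ω = ε (Subalgebra.inclusion (order_le h p n) α)}

/-- `ω` is the source type `ω(x)` at `x`: the minimum, for the entrywise order, of the types
represented by `x`. -/
def IsSource {T : Type*} [LE T] (ε : maxOrder K L → T) (p : 𝒪[K]) {Δ : L} (h : IsGenerator K Δ)
    (n : ℕ) (x : Vertex K L) (ω : T) : Prop :=
  IsLeast (typesAt ε p h n x) ω

end Orders

section Nonsplit

variable {K : Type u} [Field K] [ValuativeRel K] {L : Type v} [Field L] [Algebra K L]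

/-- The ramification degree `e` of `L/K`, where `π` is a uniformizer of `L`. -/
def ramificationDegree (π : maxOrder K L) : ℕ := (Ideal.span {π}).ramificationIdx 𝒪[K]

/-- The inertia degree `f` of `L/K`, where `π` is a uniformizer of `L`. -/
def inertiaDegree (π : maxOrder K L) : ℕ := (Ideal.span {π}).inertiaDeg 𝒪[K]

/-- The type of an element of `O_L` in the nonsplit case: its `π`-adic valuation. -/
def typeNonsplit (π a : maxOrder K L) : ℕ∞ := emultiplicity π a

/-- The type contribution `c(ω) = f ω` in the nonsplit case. -/
def contributionNonsplit (π : maxOrder K L) (ω : ℕ∞) : ℕ∞ := inertiaDegree π * ω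

variable [Algebra.IsIntegral K L]

/-- The unramified basin: the vertex of `O_0`. -/
def unramifiedBasin {p : 𝒪[K]} (hp : Irreducible p) {Δ : L} (h : IsGenerator K Δ) :
    Set (Vertex K L) :=
  {(orderLattice hp h 0).toVertex}

/-- The ramified basin: the edge with vertices `O_0` and `π O_0`. -/
def ramifiedBasin {p : 𝒪[K]} (hp : Irreducible p) {Δ : L} (h : IsGenerator K Δ)
    {π : maxOrder K L} (hπ : Irreducible π) : Set (Vertex K L) :=
  {(orderLattice hp h 0).toVertex,
    ((orderLattice hp h 0).mul (Units.mk0 (π : L) (by simpa using hπ.ne_zero))).toVertex}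

end Nonsplit

section Split

variable {K : Type u} [Field K] [ValuativeRel K]

/-- The coordinates of an element of `O_L`, for `L = K × K`, are in `O_K`. -/
theorem coordinates_mem (a : maxOrder K (K × K)) :
    (a : K × K).1 ∈ 𝒪[K] ∧ (a : K × K).2 ∈ 𝒪[K] := by
  have key : ∀ x : K, IsIntegral 𝒪[K] x → x ∈ 𝒪[K] := fun x hx =>
    (Valuation.integer.integers (ValuativeRel.valuation K)).mem_of_integral hx
  have ha : IsIntegral 𝒪[K] (a : K × K) := a.2
  exact ⟨key _ (ha.map (AlgHom.fst 𝒪[K] K K)), key _ (ha.map (AlgHom.snd 𝒪[K] K K))⟩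

/-- The type of an element of `O_L` in the split case: the `p`-adic valuations of its
coordinates. -/
def typeSplit (p : 𝒪[K]) (a : maxOrder K (K × K)) : ℕ∞ × ℕ∞ :=
  (emultiplicity p (⟨(a : K × K).1, (coordinates_mem a).1⟩ : 𝒪[K]),
    emultiplicity p (⟨(a : K × K).2, (coordinates_mem a).2⟩ : 𝒪[K]))

/-- The type contribution `c(ω) = ω_1 + ω_2` in the split case. -/
def contributionSplit (ω : ℕ∞ × ℕ∞) : ℕ∞ := ω.1 + ω.2

/-- The invertible element `(1, p^m)` of `K × K`. -/
def splitUnit {p : 𝒪[K]} (hp : Irreducible p) (m : ℤ) : (K × K)ˣ :=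
  MulEquiv.prodUnits.symm (1, (Units.mk0 (p : K) (by simpa using hp.ne_zero)) ^ m)

/-- The split basin: the apartment whose vertices are the classes of
`(1, p^m) O_0 = O_K ⊕ p^m O_K` for `m ∈ ℤ`. -/
def splitBasin {p : 𝒪[K]} (hp : Irreducible p) {Δ : K × K} (h : IsGenerator K Δ) :
    Set (Vertex K (K × K)) :=
  Set.range fun m : ℤ => ((orderLattice hp h 0).mul (splitUnit hp m)).toVertex

end Split

end ImpactedBuilding

end

/-!
Let `O = O_K`, let `N` be the norm of `L / K` and let `O_m = O + p ^ m O_L`.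

* Every lattice in `L` is `a O_m` for an invertible `a` and some `m`
  (`Coordinates.exists_eq_mul_orderLattice`). The norm form on a lattice is a primitive binary
  quadratic form up to a scalar, and such a form over a local ring represents a unit. This gives a
  basis `a, b` of the lattice in which `N a` divides all values of the norm form; then `b / a` is
  integral and `O + O (b / a)` is one of the orders `O_m`.
* In each of the three cases the basin consists of the classes of all lattices `a O_0`
  (`mem_unramifiedBasin_iff`, `mem_ramifiedBasin_iff`, `mem_splitBasin_iff`). Neighbours of
  `[a O_m]` are of the form `[b O_j]` with `j ≤ m + 1`, and `[a O_{m + 1}]` is a neighbour of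
  `[a O_m]`. So the `n`-th neighbourhood of the basin consists of the `[a O_m]` with `m ≤ n`
  (`mem_basinFiltration_iff`), and every vertex of the `n`-th layer is some `[a O_n]`.
* Scale `a` by `K^*` so that it is a primitive element of `O_n`. Any principal ideal of `O_n` in the
  class of `a O_n` is then generated by a multiple of `a`, so the type of `a` is the minimum.
* The distance from `[a O_n]` to `[O_n]` is the valuation of `N a`
  (`Coordinates.edist_mul_orderLattice`): with `d` this valuation, `p ^ d O_n ⊆ a O_n` gives a path
  of length `d`, and a path of length `l` gives `p ^ l ∈ c a O_n` for some `c ∈ O`, which for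
  `l < d` would make the conjugate of `a`, hence `a`, divisible by `p` in `O_n`.
* The valuation of `N a` is the contribution of the type of `a`. In the split case
  `N (a₁, a₂) = a₁ a₂`. When `L` is a field, `O_L` is local by Hensel's lemma
  (`isLocalRing_maxOrder`), hence a discrete valuation ring, and the norm of a uniformizer has
  valuation `f` since `e f = 2` and `N p = p ^ 2`.
-/

noncomputable section

namespace ImpactedBuilding

/-! ### Coordinates, conjugation and norm on a quadratic algebra -/

section Coordinates

variable {K : Type u} [Field K] [ValuativeRel K] {L : Type v} [CommRing L] [Algebra K L]

/-- An identification of `L` with a quadratic algebra `K[ω]`, `ω² = a + b ω` with `a` and `b`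
integral, that sends `ω` to `Δ`: the coordinates of `x + y Δ` are `x` and `y`. -/
structure Coordinates (K : Type u) [Field K] [ValuativeRel K] {L : Type v} [CommRing L]
    [Algebra K L] (Δ : L) where
  /-- The constant coefficient of `ω²`. -/
  a : 𝒪[K]
  /-- The coefficient of `ω` in `ω²`. -/
  b : 𝒪[K]
  /-- The identification. -/
  equiv : QuadraticAlgebra K (a : K) (b : K) ≃ₐ[K] L
  equiv_omega : equiv QuadraticAlgebra.omega = Δ

/-- `O_L = O_K[Δ]` is free of rank `2` over `O_K`, so the characteristic polynomial of `Δ` on it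
gives a monic quadratic equation with integral coefficients. -/
theorem IsGenerator.nonempty_coordinates [IsDiscreteValuationRing 𝒪[K]]
    (hL : Module.finrank K L = 2) {Δ : L} (h : IsGenerator K Δ) :
    Nonempty (Coordinates K Δ) := by
  have : Module.Finite K L := Module.finite_of_finrank_pos (by omega)
  have : Algebra.IsIntegral K L := inferInstance
  obtain ⟨p, hp⟩ := IsDiscreteValuationRing.exists_irreducible 𝒪[K]
  have hlat : Submodule.IsLattice K (Subalgebra.toSubmodule (order p Δ 0)) := isLattice_order hp h 0
  have e0 : order p Δ 0 = Algebra.adjoin 𝒪[K] {Δ} := by simp [order]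
  rw [e0] at hlat
  have htop : Algebra.adjoin K {Δ} = ⊤ := by
    have := hlat.span_eq_top
    rw [span_adjoin_singleton] at this
    exact Subalgebra.toSubmodule_injective (by rw [this]; rfl)
  set S := Algebra.adjoin 𝒪[K] {Δ}
  have : Module.Free 𝒪[K] S := Submodule.IsLattice.free K (Subalgebra.toSubmodule S)
  have : Module.Finite 𝒪[K] S := Submodule.IsLattice.finite K (Subalgebra.toSubmodule S)
  have hrank : Module.finrank 𝒪[K] S = 2 := by
    rw [← hL]
    exact congrArg Cardinal.toNat (Submodule.IsLattice.rank' K (Subalgebra.toSubmodule S))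
  let δ : S := ⟨Δ, Algebra.self_mem_adjoin_singleton _ _⟩
  set f := (Algebra.lmul 𝒪[K] S δ).charpoly with hf
  have hdeg : f.natDegree = 2 := by rw [hf, LinearMap.charpoly_natDegree, hrank]
  have hmonic : f.Monic := LinearMap.charpoly_monic _
  have hfδ : Polynomial.aeval δ f = 0 := by
    have h1 := LinearMap.aeval_self_charpoly (Algebra.lmul 𝒪[K] S δ)
    rw [Polynomial.aeval_algHom_apply] at h1
    simpa [hf] using LinearMap.congr_fun h1 1
  have hfΔ : Polynomial.aeval Δ f = 0 := by
    have := congrArg S.val hfδ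
    rwa [← Polynomial.aeval_algHom_apply, map_zero] at this
  have hc2 : f.coeff 2 = 1 := by rw [← hdeg]; exact hmonic
  rw [Polynomial.aeval_eq_sum_range, hdeg, Finset.sum_range_succ, Finset.sum_range_succ,
    Finset.sum_range_one, hc2] at hfΔ
  have key : Δ * Δ = ((-f.coeff 0 : 𝒪[K]) : K) • (1 : L) + ((-f.coeff 1 : 𝒪[K]) : K) • Δ := by
    have e1 : ((-f.coeff 0 : 𝒪[K]) : K) • (1 : L) = -(f.coeff 0 • (1 : L)) := by
      rw [← neg_smul]; rfl
    have e2 : ((-f.coeff 1 : 𝒪[K]) : K) • Δ = -(f.coeff 1 • Δ) := by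
      rw [← neg_smul]; rfl
    rw [e1, e2]
    linear_combination (exp := 1) (by simpa [pow_two] using hfΔ :
      f.coeff 0 • (1 : L) + f.coeff 1 • Δ + Δ * Δ = 0)
  let φ := QuadraticAlgebra.lift (R := K) (A := L) ⟨Δ, key⟩
  have hφ : φ QuadraticAlgebra.omega = Δ := by simp [φ]
  have hsurj : Function.Surjective φ := by
    rw [← AlgHom.range_eq_top, eq_top_iff, ← htop]
    exact Algebra.adjoin_le (Set.singleton_subset_iff.2 ⟨_, hφ⟩)
  have hinj : Function.Injective φ :=
    (LinearMap.injective_iff_surjective_of_finrank_eq_finrank (f := φ.toLinearMap)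
      (by rw [hL, QuadraticAlgebra.finrank_eq_two])).2 hsurj
  exact ⟨⟨_, _, AlgEquiv.ofBijective φ ⟨hinj, hsurj⟩, hφ⟩⟩

namespace Coordinates

variable {Δ : L} (C : Coordinates K Δ)

/-- The nontrivial `K`-automorphism of `L`. -/
def conj (z : L) : L := C.equiv (star (C.equiv.symm z))

/-- The norm from `L` to `K`. -/
def norm : L →* K where
  toFun z := (C.equiv.symm z).norm
  map_one' := by rw [map_one, map_one]
  map_mul' z w := by rw [map_mul, map_mul]

theorem exists_eq (z : L) : ∃ x y : K, z = C.equiv ⟨x, y⟩ :=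
  ⟨(C.equiv.symm z).re, (C.equiv.symm z).im, by simp⟩

theorem conj_equiv (x y : K) : C.conj (C.equiv ⟨x, y⟩) = C.equiv ⟨x + C.b * y, -y⟩ := by
  simp [conj]

theorem norm_equiv (x y : K) :
    C.norm (C.equiv ⟨x, y⟩) = x * x + C.b * x * y - C.a * y * y := by
  simp [norm, QuadraticAlgebra.norm_def]

theorem conj_conj (z : L) : C.conj (C.conj z) = z := by simp [conj]

theorem mul_conj (z : L) : z * C.conj z = algebraMap K L (C.norm z) := by
  have := congrArg C.equiv (QuadraticAlgebra.algebraMap_norm_eq_mul_star (C.equiv.symm z))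
  rw [map_mul, AlgEquiv.commutes, AlgEquiv.apply_symm_apply] at this
  exact this.symm

theorem conj_smul (c : K) (z : L) : C.conj (c • z) = c • C.conj z := by
  obtain ⟨x, y, rfl⟩ := C.exists_eq z
  rw [← map_smul, conj_equiv, QuadraticAlgebra.smul_mk, conj_equiv, ← map_smul]
  congr 1
  ext <;> simp; ring

theorem norm_algebraMap (c : K) : C.norm (algebraMap K L c) = c ^ 2 := by
  simp [norm]

theorem isUnit_of_norm_ne_zero {z : L} (hz : C.norm z ≠ 0) : IsUnit z := by
  have : IsUnit (z * C.conj z) := by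
    rw [C.mul_conj]; exact (IsUnit.mk0 _ hz).map _
  exact isUnit_of_mul_isUnit_left this

theorem norm_unit_ne_zero (a : Lˣ) : C.norm (a : L) ≠ 0 :=
  ((a.isUnit).map C.norm).ne_zero

theorem mem_order_iff {p : 𝒪[K]} {n : ℕ} {z : L} :
    z ∈ order p Δ n ↔ ∃ x y : 𝒪[K], z = C.equiv ⟨x, (p : K) ^ n * y⟩ := by
  have hsm : ∀ x y : 𝒪[K], C.equiv ⟨(x : K), (p : K) ^ n * y⟩
      = algebraMap 𝒪[K] L x + y • (p ^ n • Δ) := by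
    intro x y
    rw [QuadraticAlgebra.mk_eq_add_smul_omega, map_add, map_smul, C.equiv_omega, mul_comm,
      mul_smul]
    congr 1
    exact C.equiv.commutes (x : K)
  constructor
  · intro hz
    induction hz using Algebra.adjoin_induction with
    | mem w hw =>
      obtain rfl := hw
      exact ⟨0, 1, by rw [hsm]; simp⟩
    | algebraMap r => exact ⟨r, 0, by rw [hsm]; simp⟩
    | add z w _ _ hz hw =>
      obtain ⟨x, y, rfl⟩ := hz
      obtain ⟨x', y', rfl⟩ := hw
      refine ⟨x + x', y + y', ?_⟩
      rw [← map_add]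
      congr 1
      ext <;> simp; ring
    | mul z w _ _ hz hw =>
      obtain ⟨x, y, rfl⟩ := hz
      obtain ⟨x', y', rfl⟩ := hw
      refine ⟨x * x' + C.a * p ^ n * p ^ n * y * y', x * y' + y * x' + C.b * p ^ n * y * y', ?_⟩
      rw [← map_mul]
      congr 1
      ext <;> simp <;> ring
  · rintro ⟨x, y, rfl⟩
    rw [hsm]
    exact add_mem (Subalgebra.algebraMap_mem _ _)
      (Subalgebra.smul_mem _ (Algebra.self_mem_adjoin_singleton _ _) _)

theorem conj_mem_order {p : 𝒪[K]} {n : ℕ} {z : L} (hz : z ∈ order p Δ n) :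
    C.conj z ∈ order p Δ n := by
  obtain ⟨x, y, rfl⟩ := C.mem_order_iff.1 hz
  rw [C.conj_equiv]
  exact C.mem_order_iff.2 ⟨x + C.b * p ^ n * y, -y, by simp [mul_assoc]⟩

end Coordinates

theorem order_zero {Δ : L} (h : IsGenerator K Δ) (p : 𝒪[K]) : order p Δ 0 = maxOrder K L := by
  rw [← (show Algebra.adjoin 𝒪[K] {Δ} = maxOrder K L from h), order, pow_zero, one_smul]

namespace Coordinates
variable {Δ : L} (C : Coordinates K Δ)

theorem mem_maxOrder_iff (h : IsGenerator K Δ) {z : L} :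
    z ∈ maxOrder K L ↔ ∃ x y : 𝒪[K], z = C.equiv ⟨x, y⟩ := by
  rw [← order_zero h 0, C.mem_order_iff]
  simp

theorem norm_mem (h : IsGenerator K Δ) {z : L} (hz : z ∈ maxOrder K L) : C.norm z ∈ 𝒪[K] := by
  obtain ⟨x, y, rfl⟩ := (C.mem_maxOrder_iff h).1 hz
  rw [C.norm_equiv]
  exact (x * x + C.b * x * y - C.a * y * y).2

theorem conj_mem (h : IsGenerator K Δ) {z : L} (hz : z ∈ maxOrder K L) :
    C.conj z ∈ maxOrder K L := by
  rw [← order_zero h 0] at hz ⊢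
  exact C.conj_mem_order hz

end Coordinates
end Coordinates

/-! ### Operations on lattices -/

section LatticeOperations

variable {K : Type u} [Field K] [ValuativeRel K] {L : Type v} [CommRing L] [Algebra K L]

theorem Lattice.mem_mul {a : Lˣ} {M : Lattice K L} {z : L} :
    z ∈ (M.mul a).1 ↔ ∃ w ∈ M.1, (a : L) * w = z := Iff.rfl

theorem Lattice.mul_one (M : Lattice K L) : M.mul 1 = M :=
  Subtype.ext (Submodule.ext fun z => by rw [Lattice.mem_mul]; simp)

theorem mem_units_smul {c : Kˣ} {M : Submodule 𝒪[K] L} {z : L} :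
    z ∈ c • M ↔ ∃ w ∈ M, (c : K) • w = z := Iff.rfl

theorem Lattice.toVertex_eq_iff {M N : Lattice K L} :
    M.toVertex = N.toVertex ↔ ∃ c : Kˣ, M.1 = c • N.1 := Quotient.eq

/-- Multiplication of a lattice by a scalar. -/
def Lattice.scale (c : Kˣ) (M : Lattice K L) : Lattice K L :=
  ⟨c • M.1, have := M.2; inferInstance⟩

theorem Lattice.mem_scale {c : Kˣ} {M : Lattice K L} {z : L} :
    z ∈ (M.scale c).1 ↔ ∃ w ∈ M.1, (c : K) • w = z := Iff.rfl

theorem Lattice.toVertex_scale (c : Kˣ) (M : Lattice K L) : (M.scale c).toVertex = M.toVertex :=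
  Lattice.toVertex_eq_iff.2 ⟨c, rfl⟩

end LatticeOperations

/-! ### Lattices are principal over an order -/

section Principal

variable {K : Type u} [Field K] [ValuativeRel K] {L : Type v} [CommRing L] [Algebra K L]

namespace Coordinates

variable {Δ : L} (C : Coordinates K Δ)

theorem mk_add (x y x' y' : K) : (⟨x, y⟩ + ⟨x', y'⟩ : QuadraticAlgebra K (C.a : K) (C.b : K))
    = ⟨x + x', y + y'⟩ := rfl

/-- The symmetric bilinear form attached to the norm form. -/
def polar (z w : L) : K := C.norm (z + w) - C.norm z - C.norm w

theorem norm_smul_add_smul (x y : K) (z w : L) :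
    C.norm (x • z + y • w) = x ^ 2 * C.norm z + x * y * C.polar z w + y ^ 2 * C.norm w := by
  obtain ⟨z₁, z₂, rfl⟩ := C.exists_eq z
  obtain ⟨w₁, w₂, rfl⟩ := C.exists_eq w
  rw [polar, ← map_smul, ← map_smul, ← map_add, ← map_add, QuadraticAlgebra.smul_mk,
    QuadraticAlgebra.smul_mk, mk_add, mk_add]
  simp only [C.norm_equiv, smul_eq_mul]
  ring

theorem mul_self_eq (z : L) : z * z = C.polar 1 z • z - C.norm z • 1 := by
  obtain ⟨x, y, rfl⟩ := C.exists_eq z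
  have h1 : (1 : L) = C.equiv ⟨1, 0⟩ := (map_one C.equiv).symm
  rw [polar, h1, ← map_smul, ← map_smul, ← map_add, ← map_mul, ← map_sub,
    mk_add]
  simp only [C.norm_equiv]
  congr 1
  ext <;> simp <;> ring

theorem mem_maxOrder_of_norm_mem {z : L} (hN : C.norm z ∈ 𝒪[K]) (hT : C.polar 1 z ∈ 𝒪[K]) :
    z ∈ maxOrder K L := by
  refine ⟨Polynomial.X ^ 2 - (Polynomial.C (⟨_, hT⟩ : 𝒪[K]) * Polynomial.X
    - Polynomial.C (⟨_, hN⟩ : 𝒪[K])), ?_, ?_⟩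
  · monicity!
  · have e1 : algebraMap 𝒪[K] L ⟨_, hT⟩ = algebraMap K L (C.polar 1 z) := rfl
    have e2 : algebraMap 𝒪[K] L ⟨_, hN⟩ = algebraMap K L (C.norm z) := rfl
    simp only [Polynomial.eval₂_sub, Polynomial.eval₂_pow, Polynomial.eval₂_X,
      Polynomial.eval₂_mul, Polynomial.eval₂_C, e1, e2]
    rw [pow_two, C.mul_self_eq z, Algebra.smul_def, Algebra.smul_def]
    ring

/-- A lattice has a basis whose first vector attains the largest absolute value of the norm form
on the lattice: a primitive binary quadratic form over a local ring represents a unit at one of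
`(1, 0)`, `(0, 1)`, `(1, 1)`. -/
theorem exists_basis_norm_le [IsDiscreteValuationRing 𝒪[K]] (M : Lattice K L) :
    ∃ (a : Lˣ) (b : L), (∀ z, z ∈ M.1 ↔ ∃ r s : 𝒪[K], z = r • (a : L) + s • b) ∧
      ValuativeRel.valuation K (C.norm b) ≤ ValuativeRel.valuation K (C.norm a) ∧
      ValuativeRel.valuation K (C.polar a b) ≤ ValuativeRel.valuation K (C.norm a) := by
  set val := ValuativeRel.valuation K
  have hlat := M.2
  have : Module.Free 𝒪[K] M.1 := Submodule.IsLattice.free K M.1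
  have hL : Module.finrank K L = 2 := by
    rw [← C.equiv.toLinearEquiv.finrank_eq, QuadraticAlgebra.finrank_eq_two]
  have : Module.Finite K L := Module.finite_of_finrank_pos (by omega)
  have hrank : Module.finrank 𝒪[K] M.1 = 2 := by
    rw [← hL]
    exact congrArg Cardinal.toNat (Submodule.IsLattice.rank' K M.1)
  let B := Module.finBasisOfFinrankEq 𝒪[K] M.1 hrank
  obtain ⟨e₁, e₂, he⟩ : ∃ e₁ e₂ : L, ∀ z, z ∈ M.1 ↔ ∃ r s : 𝒪[K], z = r • e₁ + s • e₂ := by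
    refine ⟨B 0, B 1, fun z => ⟨fun hz => ⟨B.repr ⟨z, hz⟩ 0, B.repr ⟨z, hz⟩ 1, ?_⟩, ?_⟩⟩
    · have := congrArg Subtype.val (B.sum_repr ⟨z, hz⟩)
      rw [Fin.sum_univ_two] at this
      exact this.symm
    · rintro ⟨r, s, rfl⟩
      exact add_mem (M.1.smul_mem _ (B 0).2) (M.1.smul_mem _ (B 1).2)
  -- otherwise the norm form would vanish on the `K`-span of the lattice, which contains `1`
  have hne : ¬ (C.norm e₁ = 0 ∧ C.norm e₂ = 0 ∧ C.polar e₁ e₂ = 0) := by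
    rintro ⟨h1, h2, h3⟩
    have hspan : Submodule.span K {e₁, e₂} = ⊤ := by
      rw [eq_top_iff, ← hlat.span_eq_top, Submodule.span_le]
      intro z hz
      obtain ⟨r, s, rfl⟩ := (he z).1 hz
      exact Submodule.mem_span_pair.2 ⟨r, s, rfl⟩
    obtain ⟨x, y, hxy⟩ := Submodule.mem_span_pair.1 (hspan ▸ Submodule.mem_top : (1 : L) ∈ _)
    have := C.norm_smul_add_smul x y e₁ e₂
    rw [hxy, h1, h2, h3, map_one] at this
    simp at this
  have hval : ∀ x : K, val x = 0 ↔ x = 0 := fun x => map_eq_zero val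
  have hunit : ∀ {a : L}, val (C.norm a) ≠ 0 → ∃ a' : Lˣ, (a' : L) = a := fun ha =>
    C.isUnit_of_norm_ne_zero fun h0 => ha ((hval _).2 h0)
  by_cases h1 : val (C.norm e₂) ≤ val (C.norm e₁) ∧ val (C.polar e₁ e₂) ≤ val (C.norm e₁)
  · have h0 : val (C.norm e₁) ≠ 0 := by
      intro h0
      rw [h0, le_zero_iff, le_zero_iff, hval, hval] at h1
      exact hne ⟨(hval _).1 h0, h1⟩
    obtain ⟨a, rfl⟩ := hunit h0
    exact ⟨a, e₂, he, h1⟩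
  by_cases h2 : val (C.norm e₁) ≤ val (C.norm e₂) ∧ val (C.polar e₁ e₂) ≤ val (C.norm e₂)
  · have h0 : val (C.norm e₂) ≠ 0 := by
      intro h0
      rw [h0, le_zero_iff, le_zero_iff, hval, hval] at h2
      exact hne ⟨h2.1, (hval _).1 h0, h2.2⟩
    obtain ⟨a, rfl⟩ := hunit h0
    refine ⟨a, e₁, fun z => ?_, h2.1, ?_⟩
    · rw [he, exists_comm]
      simp only [add_comm]
    · have : C.polar a e₁ = C.polar e₁ a := by simp only [polar, add_comm]; ring
      rw [this]; exact h2.2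
  have h12 : val (C.norm e₁) < val (C.polar e₁ e₂) ∧ val (C.norm e₂) < val (C.polar e₁ e₂) := by
    rcases le_total (val (C.norm e₁)) (val (C.norm e₂)) with h | h
    · have h3 : val (C.norm e₂) < val (C.polar e₁ e₂) := by
        by_contra h4; exact h2 ⟨h, not_lt.1 h4⟩
      exact ⟨h.trans_lt h3, h3⟩
    · have h3 : val (C.norm e₁) < val (C.polar e₁ e₂) := by
        by_contra h4; exact h1 ⟨h, not_lt.1 h4⟩
      exact ⟨h3, h.trans_lt h3⟩
  have hN : C.norm (e₁ + e₂) = C.polar e₁ e₂ + (C.norm e₁ + C.norm e₂) := by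
    rw [polar]; ring
  have hvN : val (C.norm (e₁ + e₂)) = val (C.polar e₁ e₂) := by
    rw [hN]
    exact val.map_add_eq_of_lt_left (val.map_add_lt h12.1 h12.2)
  have h0 : val (C.norm (e₁ + e₂)) ≠ 0 := by
    rw [hvN]; exact (zero_le.trans_lt h12.1).ne'
  have hP : C.polar (e₁ + e₂) e₂ = C.polar e₁ e₂ + (C.norm e₂ + C.norm e₂) := by
    have h3 := C.norm_smul_add_smul 1 2 e₁ e₂
    have h4 : (1 : K) • e₁ + (2 : K) • e₂ = (e₁ + e₂) + e₂ := by module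
    rw [h4] at h3
    rw [polar, h3, hN]
    ring
  obtain ⟨a, ha⟩ := hunit h0
  refine ⟨a, e₂, fun z => ?_, ?_, ?_⟩
  · rw [he, ha]
    constructor
    · rintro ⟨r, s, rfl⟩
      exact ⟨r, s - r, by module⟩
    · rintro ⟨r, s, rfl⟩
      exact ⟨r, r + s, by module⟩
  · rw [ha, hvN]; exact h12.2.le
  · rw [ha, hvN, hP]
    exact val.map_add_le le_rfl (val.map_add_le h12.2.le h12.2.le)

end Coordinates

/-- Every lattice is a principal ideal of one of the orders `O_m`, up to an invertible factor. -/
theorem Coordinates.exists_eq_mul_orderLattice [IsDiscreteValuationRing 𝒪[K]]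
    [Algebra.IsIntegral K L] {p : 𝒪[K]} (hp : Irreducible p) {Δ : L} (h : IsGenerator K Δ)
    (C : Coordinates K Δ) (M : Lattice K L) :
    ∃ (a : Lˣ) (m : ℕ), M = (orderLattice hp h m).mul a := by
  obtain ⟨a, b, hM, hNb, hTb⟩ := C.exists_basis_norm_le M
  have ha := C.norm_unit_ne_zero a
  obtain ⟨τ, rfl⟩ : ∃ τ : L, b = a * τ := ⟨(a⁻¹ : Lˣ) * b, by simp⟩
  have hpol : C.polar (a : L) (a * τ) = C.norm a * C.polar 1 τ := by
    have : (a : L) + a * τ = a * (1 + τ) := by ring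
    rw [Coordinates.polar, Coordinates.polar, this, map_mul, map_mul, map_one]
    ring
  have hpos : 0 < ValuativeRel.valuation K (C.norm a) :=
    zero_lt_iff.2 (mt (map_eq_zero _).1 ha)
  have hτ : τ ∈ maxOrder K L := by
    refine C.mem_maxOrder_of_norm_mem ?_ ?_
    · rw [map_mul, map_mul] at hNb
      exact le_of_mul_le_mul_left (hNb.trans_eq (mul_one _).symm) hpos
    · rw [hpol, map_mul] at hTb
      exact le_of_mul_le_mul_left (hTb.trans_eq (mul_one _).symm) hpos
  obtain ⟨x, y, rfl⟩ := (C.mem_maxOrder_iff h).1 hτ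
  -- `τ` is not a scalar, since `a` and `a τ` span `L`
  have hy : y ≠ 0 := by
    rintro rfl
    have hspan : Submodule.span K {(a : L), a * C.equiv ⟨(x : K), ((0 : 𝒪[K]) : K)⟩} = ⊤ := by
      rw [eq_top_iff, ← M.2.span_eq_top, Submodule.span_le]
      intro z hz
      obtain ⟨r, s, rfl⟩ := (hM z).1 hz
      exact Submodule.mem_span_pair.2 ⟨r, s, rfl⟩
    obtain ⟨r, s, hrs⟩ := Submodule.mem_span_pair.1
      (hspan ▸ Submodule.mem_top : (a : L) * C.equiv ⟨0, 1⟩ ∈ _)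
    have h1 : (a : L) * C.equiv ⟨r + s * x, 0⟩ = a * C.equiv ⟨0, 1⟩ := by
      have e : (⟨r + s * x, 0⟩ : QuadraticAlgebra K (C.a : K) (C.b : K))
          = r • 1 + s • ⟨(x : K), ((0 : 𝒪[K]) : K)⟩ := by
        ext <;> simp [QuadraticAlgebra.re_one, QuadraticAlgebra.im_one]
      rw [← hrs, e, map_add, map_smul, map_smul, map_one, mul_add, mul_smul_comm, mul_smul_comm,
        mul_one]
    have h2 := C.equiv.injective ((Units.mul_right_inj a).1 h1)
    simpa using congrArg QuadraticAlgebra.im h2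
  obtain ⟨m, w, rfl⟩ := IsDiscreteValuationRing.eq_unit_mul_pow_irreducible hy hp
  refine ⟨a, m, Subtype.ext (Submodule.ext fun z => ?_)⟩
  have hlin : ∀ r s : 𝒪[K], r • (a : L) + s • ((a : L) *
      C.equiv ⟨(x : K), ((w * p ^ m : 𝒪[K]) : K)⟩)
        = a * C.equiv ⟨((r + s * x : 𝒪[K]) : K), (p : K) ^ m * ((s * w : 𝒪[K]) : K)⟩ := by
    intro r s
    have e : (⟨((r + s * x : 𝒪[K]) : K), (p : K) ^ m * ((s * w : 𝒪[K]) : K)⟩ :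
        QuadraticAlgebra K (C.a : K) (C.b : K))
          = (r : K) • 1 + (s : K) • ⟨(x : K), ((w * p ^ m : 𝒪[K]) : K)⟩ := by
      ext <;> simp [QuadraticAlgebra.re_one, QuadraticAlgebra.im_one]; ring
    rw [e, map_add, map_smul, map_smul, map_one, mul_add, mul_smul_comm, mul_smul_comm, mul_one]
    rfl
  rw [hM, Lattice.mem_mul]
  constructor
  · rintro ⟨r, s, rfl⟩
    exact ⟨_, C.mem_order_iff.2 ⟨_, _, rfl⟩, (hlin r s).symm⟩
  · rintro ⟨o, ho, rfl⟩
    obtain ⟨r, s, rfl⟩ := C.mem_order_iff.1 ho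
    refine ⟨r - s * ↑w⁻¹ * x, s * ↑w⁻¹, ?_⟩
    rw [hlin]
    congr 3
    · simp
    · simp [mul_assoc]

end Principal

/-! ### Distances in the tree -/

theorem coe_ne_zero_of_irreducible {K : Type u} [Field K] [ValuativeRel K]
    {p : 𝒪[K]} (hp : Irreducible p) : (p : K) ≠ 0 := by
  simpa using hp.ne_zero

section Distance

variable {K : Type u} [Field K] [ValuativeRel K] [IsDiscreteValuationRing 𝒪[K]]
variable {L : Type v} [CommRing L] [Algebra K L] {p : 𝒪[K]}

theorem mem_maximalIdeal_smul (hp : Irreducible p) {M : Submodule 𝒪[K] L} {z : L} :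
    z ∈ 𝓂[K] • M ↔ ∃ w ∈ M, (p : K) • w = z := by
  rw [hp.maximalIdeal_eq, Submodule.ideal_span_singleton_smul]
  exact Iff.rfl

/-- Neighbours in the tree come from lattices `p M ⊆ N ⊆ M`; equalities give equal vertices. -/
theorem edist_toVertex_le_one (hp : Irreducible p) {M N : Lattice K L}
    (h₁ : ∀ z ∈ M.1, (p : K) • z ∈ N.1)
    (h₂ : N.1 ≤ M.1) : (tree K L).edist M.toVertex N.toVertex ≤ 1 := by
  rw [SimpleGraph.edist_le_one_iff_adj_or_eq]
  by_cases heq : M.toVertex = N.toVertex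
  · exact Or.inr heq
  refine Or.inl ((SimpleGraph.fromRel_adj _ _ _).2 ⟨heq, Or.inl ⟨M, N, rfl, rfl, ?_, ?_⟩⟩)
  · refine lt_of_le_of_ne ?_ fun e => heq ?_
    · intro z hz
      obtain ⟨w, hw, rfl⟩ := (mem_maximalIdeal_smul hp).1 hz
      exact h₁ w hw
    · have : N = M.scale (Units.mk0 (p : K) (coe_ne_zero_of_irreducible hp)) :=
        Subtype.ext (Submodule.ext fun z => by
          rw [← e, mem_maximalIdeal_smul hp, Lattice.mem_scale, Units.val_mk0])
      rw [this, Lattice.toVertex_scale]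
  · exact lt_of_le_of_ne h₂ fun e => heq (congrArg _ (Subtype.ext e.symm))

/-- A neighbour of `[M]` is represented by a lattice between `p M` and `M`, for any
representative `M` and either orientation of the adjacency relation. -/
theorem exists_lattice_of_edist_le_one (hp : Irreducible p) {x y : Vertex K L}
    (hxy : (tree K L).edist x y ≤ 1)
    {M : Lattice K L} (hM : M.toVertex = x) :
    ∃ N : Lattice K L, N.toVertex = y ∧ (∀ z ∈ M.1, (p : K) • z ∈ N.1) ∧ N.1 ≤ M.1 := by
  rw [SimpleGraph.edist_le_one_iff_adj_or_eq] at hxy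
  rcases hxy with hadj | rfl
  · rcases ((SimpleGraph.fromRel_adj _ _ _).1 hadj).2 with
      ⟨M', N', hM', hN', h₁, h₂⟩ | ⟨N', M', hN', hM', h₁, h₂⟩
    · obtain ⟨c, hc⟩ := Lattice.toVertex_eq_iff.1 (hM.trans hM'.symm)
      refine ⟨N'.scale c, (Lattice.toVertex_scale _ _).trans hN', ?_, ?_⟩
      · intro z hz
        rw [hc] at hz
        obtain ⟨w, hw, rfl⟩ := mem_units_smul.1 hz
        exact Lattice.mem_scale.2 ⟨_, h₁.le ((mem_maximalIdeal_smul hp).2 ⟨w, hw, rfl⟩),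
          smul_comm _ _ _⟩
      · intro z hz
        obtain ⟨w, hw, rfl⟩ := Lattice.mem_scale.1 hz
        rw [hc]
        exact mem_units_smul.2 ⟨w, h₂.le hw, rfl⟩
    -- here `p N' ⊂ M' ⊂ N'`, so that `p N'` is the neighbour contained in `M'`
    · obtain ⟨c, hc⟩ := Lattice.toVertex_eq_iff.1 (hM.trans hM'.symm)
      let q : Kˣ := Units.mk0 (p : K) (coe_ne_zero_of_irreducible hp)
      refine ⟨(N'.scale q).scale c, ?_, ?_, ?_⟩
      · rw [Lattice.toVertex_scale, Lattice.toVertex_scale, hN']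
      · intro z hz
        rw [hc] at hz
        obtain ⟨w, hw, rfl⟩ := mem_units_smul.1 hz
        exact Lattice.mem_scale.2 ⟨(p : K) • w, Lattice.mem_scale.2 ⟨w, h₂.le hw, rfl⟩,
          smul_comm _ _ _⟩
      · intro z hz
        obtain ⟨_, hw', rfl⟩ := Lattice.mem_scale.1 hz
        obtain ⟨w, hw, rfl⟩ := Lattice.mem_scale.1 hw'
        rw [hc]
        exact mem_units_smul.2 ⟨_, h₁.le ((mem_maximalIdeal_smul hp).2 ⟨w, hw, rfl⟩), rfl⟩
  · exact ⟨M, hM, fun z hz => M.1.smul_mem p hz, le_rfl⟩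

/-- A walk of length `l` from `[M]` ends in the class of some `N` with `p ^ l M ⊆ N ⊆ M`; this
bounds distances from below. -/
theorem exists_lattice_of_walk (hp : Irreducible p) {x y : Vertex K L} (w : (tree K L).Walk x y)
    {M : Lattice K L} (hM : M.toVertex = x) :
    ∃ N : Lattice K L, N.toVertex = y ∧ (∀ z ∈ M.1, (p : K) ^ w.length • z ∈ N.1) ∧
      N.1 ≤ M.1 := by
  induction w generalizing M with
  | nil => exact ⟨M, hM, fun z hz => by simpa using hz, le_rfl⟩
  | cons hadj w ih =>
    obtain ⟨M', hM', h₁, h₂⟩ := exists_lattice_of_edist_le_one hp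
      (SimpleGraph.edist_eq_one_iff_adj.2 hadj).le hM
    obtain ⟨N, hN, h₃, h₄⟩ := ih hM'
    refine ⟨N, hN, fun z hz => ?_, h₄.trans h₂⟩
    rw [SimpleGraph.Walk.length_cons, pow_succ, mul_smul]
    exact h₃ _ (h₁ z hz)

/-- Conversely, `p ^ d M ⊆ N ⊆ M` bounds the distance from above. -/
theorem edist_toVertex_le (hp : Irreducible p) (d : ℕ) {M N : Lattice K L}
    (h₁ : ∀ z ∈ M.1, (p : K) ^ d • z ∈ N.1) (h₂ : N.1 ≤ M.1) :
    (tree K L).edist M.toVertex N.toVertex ≤ d := by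
  induction d generalizing N with
  | zero =>
    have : M = N := Subtype.ext (le_antisymm (fun z hz => by simpa using h₁ z hz) h₂)
    simp [this]
  | succ d ih =>
    -- the next to last lattice on the path is `N + p ^ d M`
    let q : Kˣ := Units.mk0 (p : K) (coe_ne_zero_of_irreducible hp)
    let N' : Lattice K L := ⟨N.1 ⊔ (M.scale (q ^ d)).1,
      have := N.2; have := (M.scale (q ^ d)).2; inferInstance⟩
    have hq : ((q ^ d : Kˣ) : K) = (p : K) ^ d := by simp [q]
    have h₃ : (tree K L).edist M.toVertex N'.toVertex ≤ d := by
      refine ih (fun z hz => ?_) (sup_le h₂ fun z hz => ?_)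
      · exact Submodule.mem_sup_right (Lattice.mem_scale.2 ⟨z, hz, by rw [hq]⟩)
      · obtain ⟨w, hw, rfl⟩ := Lattice.mem_scale.1 hz
        rw [hq]
        exact M.1.smul_mem (p ^ d) hw
    have h₄ : (tree K L).edist N'.toVertex N.toVertex ≤ 1 := by
      refine edist_toVertex_le_one hp (fun z hz => ?_) le_sup_left
      obtain ⟨y, hy, z', hz', rfl⟩ := Submodule.mem_sup.1 hz
      obtain ⟨w, hw, rfl⟩ := Lattice.mem_scale.1 hz'
      rw [smul_add, hq, ← mul_smul, ← pow_succ']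
      exact add_mem (N.1.smul_mem p hy) (h₁ w hw)
    calc _ ≤ _ := SimpleGraph.edist_triangle
      _ ≤ _ := add_le_add h₃ h₄
      _ = _ := by push_cast; rfl

end Distance

/-! ### Neighbourhoods of the basin -/

section Layers

variable {K : Type u} [Field K] [ValuativeRel K] [IsDiscreteValuationRing 𝒪[K]]
variable {L : Type v} [CommRing L] [Algebra K L] [Algebra.IsIntegral K L]
variable {p : 𝒪[K]} (hp : Irreducible p) {Δ : L} (h : IsGenerator K Δ)

/-- If the basin consists of the classes of the principal fractional ideals of `O_0`, then the
vertices at distance at most `k` from it are the classes of the principal fractional ideals of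
`O_m` for `m ≤ k`. -/
theorem mem_basinFiltration_iff (C : Coordinates K Δ) {P : Set (Vertex K L)}
    (hP : ∀ x, x ∈ P ↔ ∃ a : Lˣ, x = ((orderLattice hp h 0).mul a).toVertex)
    (k : ℕ) (x : Vertex K L) :
    x ∈ basinFiltration P k ↔
      ∃ (a : Lˣ) (m : ℕ), m ≤ k ∧ x = ((orderLattice hp h m).mul a).toVertex := by
  induction k generalizing x with
  | zero =>
    rw [basinFiltration, hP]
    exact ⟨fun ⟨a, ha⟩ => ⟨a, 0, le_rfl, ha⟩, fun ⟨a, m, hm, ha⟩ =>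
      ⟨a, by rwa [Nat.le_zero.1 hm] at ha⟩⟩
  | succ k ih =>
    constructor
    · rintro ⟨w, hw, hxw⟩
      obtain ⟨a, m, hm, rfl⟩ := (ih w).1 hw
      rw [SimpleGraph.edist_comm] at hxw
      obtain ⟨N, rfl, hN₁, hN₂⟩ := exists_lattice_of_edist_le_one hp hxw rfl
      obtain ⟨b, j, rfl⟩ := C.exists_eq_mul_orderLattice hp h N
      refine ⟨b, j, le_trans ?_ (Nat.succ_le_succ hm), rfl⟩
      -- `p ^ (m + 1) Δ` multiplies the neighbouring lattice into itself, so it lies in `O_j`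
      obtain ⟨o, ho, hao⟩ := Lattice.mem_mul.1
        (hN₂ (Lattice.mem_mul.2 ⟨1, one_mem (order p Δ j), mul_one _⟩))
      have ho' : p ^ m • (Δ * o) ∈ order p Δ m := by
        obtain ⟨x, y, hxy⟩ := (C.mem_maxOrder_iff h).1
          (mul_mem h.isIntegral (order_le h p m ho))
        rw [hxy]
        refine C.mem_order_iff.2 ⟨p ^ m * x, y, ?_⟩
        change ((p ^ m : 𝒪[K]) : K) • C.equiv ⟨(x : K), (y : K)⟩ = _
        rw [← map_smul]
        congr 1
      obtain ⟨r, hr, hbr⟩ := Lattice.mem_mul.1 (hN₁ _ (Lattice.mem_mul.2 ⟨_, ho', rfl⟩))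
      have hr' : r = C.equiv ⟨0, (p : K) ^ (m + 1)⟩ := by
        refine (Units.mul_right_inj b).1 (hbr.trans ?_)
        have e : C.equiv ⟨0, (p : K) ^ (m + 1)⟩ = (p : K) ^ (m + 1) • Δ := by
          calc _ = C.equiv ((p : K) ^ (m + 1) • QuadraticAlgebra.omega) := by
                congr 1
                ext <;> simp
            _ = _ := by rw [map_smul, C.equiv_omega]
        rw [e]
        change (p : K) • ((a : L) * (((p ^ m : 𝒪[K]) : K) • (Δ * o))) = _
        rw [← hao, mul_smul_comm, mul_smul_comm, ← mul_smul]
        push_cast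
        rw [← pow_succ']
        congr 1
        ring
      obtain ⟨x, y, hxy⟩ := C.mem_order_iff.1 hr
      rw [hr'] at hxy
      have him : (p : K) ^ (m + 1) = (p : K) ^ j * y :=
        congrArg QuadraticAlgebra.im (C.equiv.injective hxy)
      have hdvd : p ^ j ∣ p ^ (m + 1) := ⟨y, Subtype.ext (by push_cast; exact him)⟩
      exact (pow_dvd_pow_iff hp.ne_zero hp.not_isUnit).1 hdvd
    · rintro ⟨a, m, hm, rfl⟩
      rcases hm.lt_or_eq with hm | rfl
      · exact ⟨_, (ih _).2 ⟨a, m, Nat.lt_succ_iff.1 hm, rfl⟩, by simp⟩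
      · refine ⟨_, (ih _).2 ⟨a, k, le_rfl, rfl⟩, ?_⟩
        rw [SimpleGraph.edist_comm]
        refine edist_toVertex_le_one hp (fun z hz => ?_) fun z hz => ?_
        · obtain ⟨o, ho, rfl⟩ := Lattice.mem_mul.1 hz
          obtain ⟨x, y, rfl⟩ := C.mem_order_iff.1 ho
          refine Lattice.mem_mul.2 ⟨_, C.mem_order_iff.2 ⟨p * x, y, rfl⟩, ?_⟩
          rw [← mul_smul_comm, ← map_smul]
          congr 2
          ext <;> simp; ring
        · obtain ⟨o, ho, rfl⟩ := Lattice.mem_mul.1 hz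
          obtain ⟨x, y, rfl⟩ := C.mem_order_iff.1 ho
          refine Lattice.mem_mul.2 ⟨_, C.mem_order_iff.2 ⟨x, p * y, ?_⟩, rfl⟩
          congr 2
          push_cast
          ring

theorem exists_eq_of_mem_layer (C : Coordinates K Δ) {P : Set (Vertex K L)}
    (hP : ∀ x, x ∈ P ↔ ∃ a : Lˣ, x = ((orderLattice hp h 0).mul a).toVertex)
    {n : ℕ} {x : Vertex K L} (hx : x ∈ layer P n) :
    ∃ a : Lˣ, x = ((orderLattice hp h n).mul a).toVertex := by
  cases n with
  | zero => exact (hP x).1 hx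
  | succ n =>
    obtain ⟨a, m, hm, rfl⟩ := (mem_basinFiltration_iff hp h C hP _ _).1 hx.1
    rcases hm.lt_or_eq with hm | rfl
    · exact absurd ((mem_basinFiltration_iff hp h C hP _ _).2
        ⟨a, m, Nat.lt_succ_iff.1 hm, rfl⟩) hx.2
    · exact ⟨a, rfl⟩

end Layers

/-! ### Primitive elements and distances -/

section Primitive

variable {K : Type u} [Field K] [ValuativeRel K] {L : Type v} [CommRing L] [Algebra K L]

/-- A primitive element of `O_n`: one such that only integral scalars `d ∈ K` satisfy
`d z ∈ O_n`. -/
def IsPrimitive (p : 𝒪[K]) (Δ : L) (n : ℕ) (z : L) : Prop :=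
  z ∈ order p Δ n ∧ ∀ d : K, d • z ∈ order p Δ n → d ∈ 𝒪[K]

namespace Coordinates

variable {Δ : L} (C : Coordinates K Δ)

theorem equiv_mem_order_iff {p : 𝒪[K]} (hp : Irreducible p) {n : ℕ} {x y : K} :
    C.equiv ⟨x, (p : K) ^ n * y⟩ ∈ order p Δ n ↔ x ∈ 𝒪[K] ∧ y ∈ 𝒪[K] := by
  rw [C.mem_order_iff]
  constructor
  · rintro ⟨x', y', hxy⟩
    have h1 := C.equiv.injective hxy
    have h2 : x = x' := congrArg QuadraticAlgebra.re h1
    have h3 : (p : K) ^ n * y = (p : K) ^ n * y' := congrArg QuadraticAlgebra.im h1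
    have h4 := mul_left_cancel₀ (pow_ne_zero n (coe_ne_zero_of_irreducible hp)) h3
    rw [h2, h4]
    exact ⟨x'.2, y'.2⟩
  · rintro ⟨hx, hy⟩
    exact ⟨⟨x, hx⟩, ⟨y, hy⟩, rfl⟩

theorem exists_isPrimitive_smul (C : Coordinates K Δ) {p : 𝒪[K]} (hp : Irreducible p)
    (n : ℕ) {z : L} (hz : z ≠ 0) :
    ∃ c : Kˣ, IsPrimitive p Δ n ((c : K) • z) := by
  have hpn : (p : K) ^ n ≠ 0 := pow_ne_zero n (coe_ne_zero_of_irreducible hp)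
  obtain ⟨x, y, rfl⟩ : ∃ x y : K, z = C.equiv ⟨x, (p : K) ^ n * y⟩ := by
    obtain ⟨x, y, rfl⟩ := C.exists_eq z
    exact ⟨x, ((p : K) ^ n)⁻¹ * y, by rw [mul_inv_cancel_left₀ hpn]⟩
  have hsm : ∀ d : K,
      d • C.equiv ⟨x, (p : K) ^ n * y⟩ = C.equiv ⟨d * x, (p : K) ^ n * (d * y)⟩ := by
    intro d
    rw [← map_smul]
    congr 1
    ext <;> simp; ring
  have hmem : ∀ c d : K, d • c • C.equiv ⟨x, (p : K) ^ n * y⟩ ∈ order p Δ n ↔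
      d * (c * x) ∈ 𝒪[K] ∧ d * (c * y) ∈ 𝒪[K] := by
    intro c d
    rw [← mul_smul, hsm, C.equiv_mem_order_iff hp, mul_assoc, mul_assoc]
  have hne : ¬ (x = 0 ∧ y = 0) := by
    rintro ⟨rfl, rfl⟩
    refine hz ?_
    rw [mul_zero]
    exact map_zero C.equiv
  have hval : ∀ {s t : K}, t ≠ 0 → ValuativeRel.valuation K s ≤ ValuativeRel.valuation K t →
      t⁻¹ * s ∈ 𝒪[K] := by
    intro s t ht hst
    change ValuativeRel.valuation K _ ≤ 1
    rw [mul_comm, ← div_eq_mul_inv, map_div₀]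
    exact div_le_one_of_le₀ hst zero_le
  -- divide by the coordinate of largest absolute value
  rcases le_total (ValuativeRel.valuation K y) (ValuativeRel.valuation K x) with hxy | hxy
  · have hx : x ≠ 0 := by
      rintro rfl
      rw [map_zero, le_zero_iff, map_eq_zero] at hxy
      exact hne ⟨rfl, hxy⟩
    refine ⟨(Units.mk0 x hx)⁻¹, ?_, fun d hd => ?_⟩
    · rw [← one_smul K ((_ : K) • _), hmem]
      refine ⟨by simp [hx], ?_⟩
      rw [one_mul, Units.val_inv_eq_inv_val, Units.val_mk0]
      exact hval hx hxy
    · simpa [hx] using ((hmem _ _).1 hd).1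
  · have hy : y ≠ 0 := by
      rintro rfl
      rw [map_zero, le_zero_iff, map_eq_zero] at hxy
      exact hne ⟨hxy, rfl⟩
    refine ⟨(Units.mk0 y hy)⁻¹, ?_, fun d hd => ?_⟩
    · rw [← one_smul K ((_ : K) • _), hmem]
      refine ⟨?_, by simp [hy]⟩
      rw [one_mul, Units.val_inv_eq_inv_val, Units.val_mk0]
      exact hval hy hxy
    · simpa [hy] using ((hmem _ _).1 hd).2

/-- The class of `α O_n`, for a primitive `α`, is at distance the valuation of the norm of `α` from
that of `O_n`. The inclusion `N(α) O_n ⊆ α O_n` gives a path of this length. Along a shorter path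
some `p ^ l` would be a multiple of `α` with `l < d`, so that `p` would divide the conjugate of
`α` in `O_n`. -/
theorem edist_mul_orderLattice [IsDiscreteValuationRing 𝒪[K]] [Algebra.IsIntegral K L]
    {p : 𝒪[K]} (hp : Irreducible p) (h : IsGenerator K Δ) {n : ℕ} {α : Lˣ}
    (hα : IsPrimitive p Δ n (α : L)) {d : ℕ} (u : 𝒪[K]ˣ)
    (hN : C.norm (α : L) = (u * p ^ d : 𝒪[K])) :
    (tree K L).edist ((orderLattice hp h n).mul α).toVertex (orderLattice hp h n).toVertex = d := by
  have hp0 := coe_ne_zero_of_irreducible hp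
  have hu : ((u⁻¹ : 𝒪[K]ˣ) : 𝒪[K]) * (u : 𝒪[K]) = 1 := u.inv_mul
  have huK : (((u⁻¹ : 𝒪[K]ˣ) : 𝒪[K]) : K) * ((u : 𝒪[K]) : K) = 1 := by
    rw [← Subring.coe_mul, hu]; rfl
  have hconj : (α : L) * C.conj α = (((u : 𝒪[K]) : K) * (p : K) ^ d) • (1 : L) := by
    rw [C.mul_conj, hN, Algebra.algebraMap_eq_smul_one]
    push_cast
    rfl
  rw [SimpleGraph.edist_comm]
  refine le_antisymm (edist_toVertex_le hp d ?_ ?_) ?_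
  · intro z hz
    refine Lattice.mem_mul.2 ⟨((u⁻¹ : 𝒪[K]ˣ) : 𝒪[K]) • (C.conj α * z), ?_, ?_⟩
    · exact (orderLattice hp h n).1.smul_mem _
        (Subalgebra.mul_mem (order p Δ n) (C.conj_mem_order hα.1) hz)
    · change (α : L) * ((((u⁻¹ : 𝒪[K]ˣ) : 𝒪[K]) : K) • (C.conj α * z)) = _
      rw [mul_smul_comm, ← mul_assoc, hconj, smul_mul_assoc, one_mul, ← mul_smul, ← mul_assoc,
        huK, one_mul]
  · intro z hz
    obtain ⟨o, ho, rfl⟩ := Lattice.mem_mul.1 hz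
    exact Subalgebra.mul_mem (order p Δ n) hα.1 ho
  · refine le_iInf fun w => ?_
    rw [Nat.cast_le]
    obtain ⟨N, hNα, hN₁, hN₂⟩ := exists_lattice_of_walk hp w rfl
    obtain ⟨c, hc⟩ := Lattice.toVertex_eq_iff.1 hNα
    have hcα : (c : K) • (α : L) ∈ N.1 := by
      rw [hc]
      exact mem_units_smul.2 ⟨α, Lattice.mem_mul.2 ⟨1, one_mem (order p Δ n), mul_one _⟩, rfl⟩
    have hc𝒪 : (c : K) ∈ 𝒪[K] := hα.2 _ (hN₂ hcα)
    have h1 := hN₁ 1 (one_mem (order p Δ n))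
    rw [hc] at h1
    obtain ⟨_, hαo, h2⟩ := mem_units_smul.1 h1
    obtain ⟨o, ho, rfl⟩ := Lattice.mem_mul.1 hαo
    by_contra! hlt
    obtain ⟨k, rfl⟩ := Nat.exists_eq_add_of_lt hlt
    have h3 : (p : K) ^ w.length • C.conj α
        = (p : K) ^ w.length • (p : K) • ((p ^ k * u * ⟨c, hc𝒪⟩ : 𝒪[K]) • o) := by
      calc (p : K) ^ w.length • C.conj α = ((p : K) ^ w.length • (1 : L)) * C.conj α := by
            rw [smul_mul_assoc, one_mul]
        _ = ((c : K) • ((α : L) * o)) * C.conj α := by rw [h2]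
        _ = (c : K) • (((α : L) * C.conj α) * o) := by
            rw [smul_mul_assoc, mul_right_comm]
        _ = (p : K) ^ w.length • (p : K) • (((p ^ k * u * ⟨c, hc𝒪⟩ : 𝒪[K]) : K) • o) := by
            rw [hconj, smul_mul_assoc, one_mul, ← mul_smul, ← mul_smul, ← mul_smul]
            congr 1
            push_cast
            ring
        _ = _ := rfl
    have h4 := congrArg (((p : K) ^ w.length)⁻¹ • ·) h3
    simp only [inv_smul_smul₀ (pow_ne_zero w.length hp0)] at h4
    have h5 : (p : K)⁻¹ • C.conj α ∈ order p Δ n := by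
      rw [h4, inv_smul_smul₀ hp0]
      exact (orderLattice hp h n).1.smul_mem _ ho
    have h6 := C.conj_mem_order h5
    rw [C.conj_smul, C.conj_conj] at h6
    have h7 := hα.2 _ h6
    exact hp.not_isUnit (IsUnit.of_mul_eq_one ⟨_, h7⟩ (Subtype.ext (mul_inv_cancel₀ hp0)))

end Coordinates
end Primitive

theorem mem_idealToSubmodule_span {K : Type u} [Field K] [ValuativeRel K] {L : Type v}
    [CommRing L] [Algebra K L] {p : 𝒪[K]} {Δ : L} {n : ℕ} {α : order p Δ n} {z : L} :
    z ∈ idealToSubmodule (Ideal.span {α}) ↔ ∃ o ∈ order p Δ n, (α : L) * o = z := by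
  constructor
  · rintro ⟨w, hw, rfl⟩
    obtain ⟨o, rfl⟩ := Ideal.mem_span_singleton.1 hw
    exact ⟨o, o.2, rfl⟩
  · rintro ⟨o, ho, rfl⟩
    exact ⟨α * ⟨o, ho⟩, Ideal.mem_span_singleton.2 ⟨_, rfl⟩, rfl⟩

/-! ### Minimal types on a layer -/

section Sources

variable {K : Type u} [Field K] [ValuativeRel K] [IsDiscreteValuationRing 𝒪[K]]
variable {L : Type v} [CommRing L] [Algebra K L] [Algebra.IsIntegral K L]
variable {p : 𝒪[K]} (hp : Irreducible p) {Δ : L} (h : IsGenerator K Δ)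

/-- The common form of the three cases. The type `ε` only has to be monotone for divisibility,
with the valuation of the norm as its contribution. -/
theorem exists_isSource_of_mem_layer (C : Coordinates K Δ) {P : Set (Vertex K L)}
    (hP : ∀ x, x ∈ P ↔ ∃ a : Lˣ, x = ((orderLattice hp h 0).mul a).toVertex)
    {T : Type*} [LE T] (ε : maxOrder K L → T) (c : T → ℕ∞)
    (hε : ∀ a b : maxOrder K L, a ∣ b → ε a ≤ ε b)
    (hc : ∀ (a : maxOrder K L) (u : 𝒪[K]ˣ) (d : ℕ),
      C.norm (a : L) = (u * p ^ d : 𝒪[K]) → c (ε a) = d)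
    {n : ℕ} {x : Vertex K L} (hx : x ∈ layer P n) :
    ∃ ω : T, IsSource ε p h n x ω ∧
      (tree K L).edist x (orderLattice hp h n).toVertex = c ω := by
  obtain ⟨a, rfl⟩ := exists_eq_of_mem_layer hp h C hP hx
  have : Nontrivial L := C.equiv.symm.toEquiv.nontrivial
  obtain ⟨s, hs⟩ := C.exists_isPrimitive_smul hp n a.ne_zero
  -- the primitive representative of the class
  obtain ⟨α, hα⟩ : ∃ α : Lˣ, (α : L) = (s : K) • (a : L) :=
    ⟨Units.map (algebraMap K L : K →* L) s * a, by simp [Algebra.smul_def]⟩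
  rw [← hα] at hs
  have hx' : ((orderLattice hp h n).mul a).toVertex = ((orderLattice hp h n).mul α).toVertex := by
    have : (orderLattice hp h n).mul α = ((orderLattice hp h n).mul a).scale s := by
      refine Subtype.ext (Submodule.ext fun z => ?_)
      rw [Lattice.mem_mul, Lattice.mem_scale, hα]
      constructor
      · rintro ⟨w, hw, rfl⟩
        exact ⟨_, Lattice.mem_mul.2 ⟨w, hw, rfl⟩, (smul_mul_assoc _ _ _).symm⟩
      · rintro ⟨_, hw', rfl⟩
        obtain ⟨w, hw, rfl⟩ := Lattice.mem_mul.1 hw'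
        exact ⟨w, hw, smul_mul_assoc _ _ _⟩
    rw [this, Lattice.toVertex_scale]
  rw [hx']
  let α' : order p Δ n := ⟨α, hs.1⟩
  refine ⟨ε (Subalgebra.inclusion (order_le h p n) α'),
    ⟨⟨Ideal.span {α'}, α', rfl, ?_, rfl⟩, ?_⟩, ?_⟩
  · exact ⟨(orderLattice hp h n).mul α, Submodule.ext fun z =>
      Lattice.mem_mul.trans (mem_idealToSubmodule_span (α := α')).symm, rfl⟩
  · rintro _ ⟨_, β, rfl, ⟨M, hM, hMx⟩, rfl⟩
    obtain ⟨t, ht⟩ := Lattice.toVertex_eq_iff.1 hMx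
    have h1 : (t : K) • (α : L) ∈ M.1 := by
      rw [ht]
      exact mem_units_smul.2 ⟨α, Lattice.mem_mul.2 ⟨1, one_mem (order p Δ n), mul_one _⟩, rfl⟩
    rw [hM] at h1
    obtain ⟨o, ho, hβo⟩ := mem_idealToSubmodule_span.1 h1
    have ht𝒪 : (t : K) ∈ 𝒪[K] := hs.2 _ (hβo ▸ mul_mem β.2 ho)
    have h2 : (β : L) ∈ M.1 := by
      rw [hM]
      exact mem_idealToSubmodule_span.2 ⟨1, one_mem _, mul_one _⟩
    rw [ht] at h2
    obtain ⟨_, h3, h4⟩ := mem_units_smul.1 h2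
    obtain ⟨o', ho', rfl⟩ := Lattice.mem_mul.1 h3
    refine hε _ _ ⟨(⟨(t : K), ht𝒪⟩ : 𝒪[K]) • ⟨o', order_le h p n ho'⟩, Subtype.ext ?_⟩
    change (β : L) = (α : L) * ((t : K) • o')
    rw [mul_smul_comm, h4]
  · have hmem := C.norm_mem h (order_le h p n hs.1)
    have hne : (⟨C.norm (α : L), hmem⟩ : 𝒪[K]) ≠ 0 := fun h0 =>
      C.norm_unit_ne_zero α (congrArg Subtype.val h0)
    obtain ⟨d, u, hd⟩ := IsDiscreteValuationRing.eq_unit_mul_pow_irreducible hne hp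
    have hN : C.norm (α : L) = (u * p ^ d : 𝒪[K]) := congrArg Subtype.val hd
    rw [C.edist_mul_orderLattice hp h hs u hN]
    exact (hc _ u d hN).symm

end Sources

/-! ### Classes of fractional ideals of the maximal order -/

section Basins

variable {K : Type u} [Field K] [ValuativeRel K] {L : Type v} [CommRing L] [Algebra K L]
variable {p : 𝒪[K]} {Δ : L}

/-- Scalars of `K` and units of `O_L` do not change the class of a fractional ideal of `O_0`. -/
theorem toVertex_mul_orderLattice_zero_eq [Algebra.IsIntegral K L] (hp : Irreducible p)
    (h : IsGenerator K Δ) {a b : Lˣ} (c : Kˣ) (w : (maxOrder K L)ˣ)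
    (hab : (a : L) = (c : K) • ((b : L) * ((w : maxOrder K L) : L))) :
    ((orderLattice hp h 0).mul a).toVertex = ((orderLattice hp h 0).mul b).toVertex := by
  have hO : ∀ z, z ∈ (orderLattice hp h 0).1 ↔ z ∈ maxOrder K L := fun z => by
    rw [← order_zero h p]; rfl
  refine Lattice.toVertex_eq_iff.2 ⟨c, Submodule.ext fun z => ?_⟩
  rw [Lattice.mem_mul, mem_units_smul, hab]
  constructor
  · rintro ⟨o, ho, rfl⟩
    refine ⟨_, Lattice.mem_mul.2 ⟨((w : maxOrder K L) : L) * o,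
      (hO _).2 (mul_mem (w : maxOrder K L).2 ((hO _).1 ho)), rfl⟩, ?_⟩
    rw [smul_mul_assoc, mul_assoc]
  · rintro ⟨_, hz, rfl⟩
    obtain ⟨o, ho, rfl⟩ := Lattice.mem_mul.1 hz
    refine ⟨((w⁻¹ : (maxOrder K L)ˣ) : maxOrder K L) * o,
      (hO _).2 (mul_mem ((w⁻¹ : (maxOrder K L)ˣ) : maxOrder K L).2 ((hO _).1 ho)), ?_⟩
    have hw : ((w : maxOrder K L) : L) * (((w⁻¹ : (maxOrder K L)ˣ) : maxOrder K L) : L) = 1 :=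
      congrArg Subtype.val w.mul_inv
    rw [smul_mul_assoc, mul_assoc, ← mul_assoc ((w : maxOrder K L) : L), hw, one_mul]

theorem emultiplicity_units_mul_pow {R : Type*} [CommRing R] [IsDomain R] {q : R}
    (hq : Irreducible q) (u : Rˣ) (d : ℕ) : emultiplicity q (u * q ^ d) = d := by
  rw [emultiplicity_eq_of_associated_right (associated_unit_mul_left (q ^ d) u u.isUnit)]
  exact emultiplicity_pow_self hq.ne_zero hq.not_isUnit d

end Basins

/-! ### The split case -/

section Split

variable {K : Type u} [Field K] [ValuativeRel K] {p : 𝒪[K]}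

/-- Both coordinates of `z` are roots of the quadratic polynomial with coefficients the trace and
the norm of `z`. -/
theorem Coordinates.norm_prod {Δ : K × K} (C : Coordinates K Δ) (z : K × K) :
    C.norm z = z.1 * z.2 := by
  obtain ⟨x, y⟩ := z
  by_cases hxy : x = y
  · subst hxy
    have := C.norm_algebraMap x
    rw [pow_two] at this
    exact this
  · have h1 := C.mul_self_eq (x, y)
    simp only [Prod.ext_iff, Prod.fst_mul, Prod.snd_mul, Prod.fst_sub, Prod.snd_sub, Prod.smul_fst,
      Prod.smul_snd, Prod.fst_one, Prod.snd_one, smul_eq_mul, mul_one] at h1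
    have h2 : C.polar 1 (x, y) = x + y :=
      mul_right_cancel₀ (sub_ne_zero.2 hxy) (by linear_combination -h1.1 + h1.2)
    rw [h2] at h1
    linear_combination h1.1

theorem mem_splitBasin_iff [IsDiscreteValuationRing 𝒪[K]] (hp : Irreducible p) {Δ : K × K}
    (h : IsGenerator K Δ) (x : Vertex K (K × K)) :
    x ∈ splitBasin hp h ↔ ∃ a : (K × K)ˣ, x = ((orderLattice hp h 0).mul a).toVertex := by
  constructor
  · rintro ⟨m, rfl⟩
    exact ⟨_, rfl⟩
  · rintro ⟨a, rfl⟩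
    have ha₁ : (a : K × K).1 ≠ 0 := (a.isUnit.map (RingHom.fst K K)).ne_zero
    have ha₂ : (a : K × K).2 ≠ 0 := (a.isUnit.map (RingHom.snd K K)).ne_zero
    obtain ⟨m, u, hu⟩ := IsDiscreteValuationRing.exists_units_eq_smul_zpow_of_irreducible hp
      (div_ne_zero ha₂ ha₁)
    have hint : ∀ r : 𝒪[K], ((1 : K), (r : K)) ∈ maxOrder K (K × K) := fun r =>
      IsIntegral.pair isIntegral_one (isIntegral_algebraMap (x := r))
    let w : (maxOrder K (K × K))ˣ :=
      ⟨⟨_, hint u⟩, ⟨_, hint (u⁻¹ : 𝒪[K]ˣ)⟩,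
        Subtype.ext (Prod.ext (mul_one _) (congrArg Subtype.val u.mul_inv)),
        Subtype.ext (Prod.ext (mul_one _) (congrArg Subtype.val u.inv_mul))⟩
    refine ⟨m, (toVertex_mul_orderLattice_zero_eq hp h (Units.mk0 _ ha₁) w ?_).symm⟩
    have hu' : (a : K × K).2 / (a : K × K).1 = ((u : 𝒪[K]) : K) * (p : K) ^ m := hu
    have e : ((splitUnit hp m : (K × K)ˣ) : K × K) = (1, (p : K) ^ m) := by
      refine Prod.ext rfl ?_
      change (((Units.mk0 (p : K) _) ^ m : Kˣ) : K) = _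
      rw [Units.val_zpow_eq_zpow_val, Units.val_mk0]
    rw [e]
    refine Prod.ext ?_ ?_
    · change (a : K × K).1 = (a : K × K).1 * (1 * 1)
      ring
    · change (a : K × K).2 = (a : K × K).1 * ((p : K) ^ m * ((u : 𝒪[K]) : K))
      rw [mul_comm ((p : K) ^ m), ← hu']
      field_simp

theorem contributionSplit_typeSplit [IsDiscreteValuationRing 𝒪[K]] (hp : Irreducible p)
    {Δ : K × K} (C : Coordinates K Δ) (a : maxOrder K (K × K)) (u : 𝒪[K]ˣ) (d : ℕ)
    (ha : C.norm (a : K × K) = (u * p ^ d : 𝒪[K])) :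
    contributionSplit (typeSplit p a) = d := by
  rw [C.norm_prod] at ha
  rw [← emultiplicity_units_mul_pow hp u d, ← (Subtype.ext ha :
    (⟨(a : K × K).1, (coordinates_mem a).1⟩ * ⟨(a : K × K).2, (coordinates_mem a).2⟩ : 𝒪[K]) = _),
    emultiplicity_mul hp.prime]
  rfl

theorem typeSplit_mono (p : 𝒪[K]) {a b : maxOrder K (K × K)} (hab : a ∣ b) :
    typeSplit p a ≤ typeSplit p b := by
  obtain ⟨c, rfl⟩ := hab
  exact ⟨emultiplicity_le_emultiplicity_of_dvd_right ⟨⟨_, (coordinates_mem c).1⟩, rfl⟩,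
    emultiplicity_le_emultiplicity_of_dvd_right ⟨⟨_, (coordinates_mem c).2⟩, rfl⟩⟩

end Split

/-! ### The maximal order is local in the nonsplit case -/

section Nonsplit

variable {K : Type u} [Field K] [ValuativeRel K] {L : Type v} [Field L] [Algebra K L]
variable {p : 𝒪[K]} {Δ : L}

/-- The norm as a map from `O_L` to `O_K`. -/
def Coordinates.intNorm (C : Coordinates K Δ) (h : IsGenerator K Δ) :
    maxOrder K L →* 𝒪[K] where
  toFun a := ⟨C.norm (a : L), C.norm_mem h a.2⟩
  map_one' := Subtype.ext (map_one C.norm)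
  map_mul' a b := Subtype.ext (map_mul C.norm (a : L) (b : L))

theorem Coordinates.isUnit_of_isUnit_intNorm (C : Coordinates K Δ) (h : IsGenerator K Δ)
    {a : maxOrder K L} (ha : IsUnit (C.intNorm h a)) : IsUnit a := by
  have h1 : a * ⟨C.conj a, C.conj_mem h a.2⟩ = algebraMap 𝒪[K] (maxOrder K L) (C.intNorm h a) :=
    Subtype.ext (C.mul_conj a)
  exact isUnit_of_mul_isUnit_left (h1 ▸ ha.map _)

open Polynomial in
/-- Hensel's lemma makes `O_L` local: if neither `z` nor `1 - z` is a unit then the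
characteristic polynomial of `z` is `X² - X` modulo the maximal ideal of `O_K`, hence splits
over `K`. -/
theorem isLocalRing_maxOrder [IsDiscreteValuationRing 𝒪[K]] [HenselianRing 𝒪[K] 𝓂[K]]
    (C : Coordinates K Δ) (h : IsGenerator K Δ) : IsLocalRing (maxOrder K L) := by
  refine IsLocalRing.of_isUnit_or_isUnit_one_sub_self fun z => ?_
  by_contra! hz
  have hN : C.intNorm h z ∈ 𝓂[K] := fun hu => hz.1 (C.isUnit_of_isUnit_intNorm h hu)
  have hN' : C.intNorm h (1 - z) ∈ 𝓂[K] := fun hu => hz.2 (C.isUnit_of_isUnit_intNorm h hu)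
  have h1 : C.norm ((1 - z : maxOrder K L) : L) = 1 - C.polar 1 z + C.norm (z : L) := by
    have := C.norm_smul_add_smul 1 (-1) 1 (z : L)
    rw [map_one] at this
    rw [show ((1 - z : maxOrder K L) : L) = (1 : K) • 1 + (-1 : K) • (z : L) by
      push_cast; module, this]
    ring
  obtain ⟨t, ht⟩ : ∃ t : 𝒪[K], (t : K) = C.polar 1 z :=
    ⟨1 + C.intNorm h z - C.intNorm h (1 - z), by
      change 1 + C.norm (z : L) - C.norm ((1 - z : maxOrder K L) : L) = _
      rw [h1]; ring⟩
  have h2 : C.intNorm h (1 - z) = 1 - t + C.intNorm h z :=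
    Subtype.ext (by rw [← ht] at h1; exact h1)
  have ht1 : 1 - t ∈ 𝓂[K] := by
    rw [h2] at hN'
    exact (Ideal.add_mem_iff_left _ hN).1 hN'
  have htu : IsUnit t := by
    by_contra htu
    exact (Ideal.ne_top_iff_one 𝓂[K]).1 (IsLocalRing.maximalIdeal.isMaximal _).ne_top
      (by simpa using add_mem ht1 (show t ∈ 𝓂[K] from htu))
  let f : 𝒪[K][X] := X ^ 2 - (Polynomial.C t * X - Polynomial.C (C.intNorm h z))
  have hf : f.Monic := by simp only [f]; monicity!
  obtain ⟨r, hr, -⟩ := HenselianRing.is_henselian (I := 𝓂[K]) f hf 0 (by simpa [f] using hN)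
    (by
      have : f.derivative.eval 0 = -t := by simp [f]
      rw [this]
      exact htu.neg.map _)
  have hr' : r ^ 2 - (t * r - C.intNorm h z) = 0 := by simpa [f, IsRoot] using hr
  -- `z` is a root of a polynomial that splits over `O_K`, so that it lies in `O_K`
  have hz2 : z ^ 2 - (algebraMap 𝒪[K] (maxOrder K L) t * z
      - algebraMap 𝒪[K] (maxOrder K L) (C.intNorm h z)) = 0 := by
    refine Subtype.ext ?_
    have h3 := C.mul_self_eq (z : L)
    rw [← ht, Algebra.smul_def, Algebra.smul_def, mul_one] at h3
    change (z : L) ^ 2 - (algebraMap K L t * (z : L) - algebraMap K L (C.norm (z : L))) = 0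
    linear_combination h3
  have hr2 := congrArg (algebraMap 𝒪[K] (maxOrder K L)) hr'
  simp only [map_sub, map_pow, map_mul, map_zero] at hr2
  have hfac : (z - algebraMap 𝒪[K] (maxOrder K L) r)
      * (z - algebraMap 𝒪[K] (maxOrder K L) (t - r)) = 0 := by
    rw [map_sub]
    linear_combination hz2 - hr2
  obtain ⟨s, rfl⟩ : ∃ s : 𝒪[K], z = algebraMap 𝒪[K] (maxOrder K L) s := by
    rcases mul_eq_zero.1 hfac with h4 | h4
    · exact ⟨_, sub_eq_zero.1 h4⟩
    · exact ⟨_, sub_eq_zero.1 h4⟩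
  rcases IsLocalRing.isUnit_or_isUnit_one_sub_self s with hs | hs
  · exact hz.1 (hs.map _)
  · exact hz.2 (by simpa using hs.map (algebraMap 𝒪[K] (maxOrder K L)))

end Nonsplit

/-! ### Ramification and inertia in the nonsplit case -/

section Ramification

variable {K : Type u} [Field K] [ValuativeRel K] {L : Type v} [Field L] [Algebra K L]
variable {p : 𝒪[K]} {Δ : L}

theorem faithfulSMul_maxOrder : FaithfulSMul 𝒪[K] (maxOrder K L) :=
  (faithfulSMul_iff_algebraMap_injective _ _).2 fun _ _ hxy =>
    Subtype.ext ((algebraMap K L).injective (congrArg Subtype.val hxy))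

theorem isTorsionFree_integers : Module.IsTorsionFree 𝒪[K] L :=
  Module.isTorsionFree_iff_faithfulSMul.2 <| (faithfulSMul_iff_algebraMap_injective _ _).2
    fun _ _ hxy => Subtype.ext ((algebraMap K L).injective hxy)

theorem isTorsionFree_maxOrder : Module.IsTorsionFree 𝒪[K] (maxOrder K L) :=
  Module.isTorsionFree_iff_faithfulSMul.2 faithfulSMul_maxOrder

theorem isDedekindDomain_maxOrder [CharZero K] [FiniteDimensional K L]
    [IsDiscreteValuationRing 𝒪[K]] : IsDedekindDomain (maxOrder K L) :=
  integralClosure.isDedekindDomain 𝒪[K] K L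

theorem isDiscreteValuationRing_maxOrder [CharZero K] [FiniteDimensional K L]
    [IsDiscreteValuationRing 𝒪[K]] [IsLocalRing (maxOrder K L)] {π : maxOrder K L}
    (hπ : Irreducible π) : IsDiscreteValuationRing (maxOrder K L) := by
  have := isDedekindDomain_maxOrder (K := K) (L := L)
  refine ((IsDiscreteValuationRing.TFAE (maxOrder K L) fun hF => ?_).out 2 0).1 this
  obtain ⟨b, hb⟩ := hF.mul_inv_cancel hπ.ne_zero
  exact hπ.not_isUnit (IsUnit.of_mul_eq_one b hb)

theorem ramificationDegree_mul_inertiaDegree [CharZero K] [FiniteDimensional K L]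
    [IsDiscreteValuationRing 𝒪[K]] [IsDiscreteValuationRing (maxOrder K L)] (hp : Irreducible p)
    {π : maxOrder K L} (hπ : Irreducible π) :
    ramificationDegree π * inertiaDegree π = Module.finrank K L := by
  have : Module.Finite 𝒪[K] (maxOrder K L) := IsIntegralClosure.finite 𝒪[K] K L (maxOrder K L)
  have := faithfulSMul_maxOrder (K := K) (L := L)
  have := isTorsionFree_integers (K := K) (L := L)
  have : Module.Free 𝒪[K] (maxOrder K L) :=
    IsIntegralClosure.module_free 𝒪[K] K L (maxOrder K L)
  have hp0 : 𝓂[K] ≠ ⊥ := by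
    rw [hp.maximalIdeal_eq, Ne, Ideal.span_singleton_eq_bot]
    exact hp.ne_zero
  have hprimes := IsLocalRing.primesOver_eq (maxOrder K L) hp0
  have hmem : IsLocalRing.maximalIdeal (maxOrder K L) ∈ 𝓂[K].primesOver (maxOrder K L) := by
    rw [hprimes]; rfl
  let _ : Unique (𝓂[K].primesOver (maxOrder K L)) :=
    ⟨⟨⟨_, hmem⟩⟩, fun q => Subtype.ext (hprimes.le q.2)⟩
  let _ : Fintype (𝓂[K].primesOver (maxOrder K L)) := Unique.fintype
  have hsum := Ideal.sum_ramification_inertia_eq_finrank 𝓂[K] (maxOrder K L)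
  rw [Fintype.sum_unique, IsIntegralClosure.rank 𝒪[K] K L (maxOrder K L)] at hsum
  rw [ramificationDegree, inertiaDegree, ← hπ.maximalIdeal_eq]
  exact hsum

/-- The ramification degree is the exponent of a uniformizer of `L` in a uniformizer of `K`. -/
theorem exists_algebraMap_eq_unit_mul_pow [CharZero K] [FiniteDimensional K L]
    [IsDiscreteValuationRing 𝒪[K]] [IsDiscreteValuationRing (maxOrder K L)] (hp : Irreducible p)
    {π : maxOrder K L} (hπ : Irreducible π) :
    ∃ w : (maxOrder K L)ˣ,
      algebraMap 𝒪[K] (maxOrder K L) p = w * π ^ ramificationDegree π := by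
  have := faithfulSMul_maxOrder (K := K) (L := L)
  have := isTorsionFree_maxOrder (K := K) (L := L)
  have : Module.Finite 𝒪[K] (maxOrder K L) := IsIntegralClosure.finite 𝒪[K] K L (maxOrder K L)
  have hinj : Function.Injective (algebraMap 𝒪[K] (maxOrder K L)) :=
    FaithfulSMul.algebraMap_injective _ _
  obtain ⟨e, w, hw⟩ := IsDiscreteValuationRing.eq_unit_mul_pow_irreducible
    ((map_ne_zero_iff _ hinj).2 hp.ne_zero) hπ
  refine ⟨w, ?_⟩
  have hp0 : 𝓂[K] ≠ ⊥ := by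
    rw [hp.maximalIdeal_eq, Ne, Ideal.span_singleton_eq_bot]
    exact hp.ne_zero
  have : (Ideal.span {π}).IsPrime := by
    rw [← hπ.maximalIdeal_eq]; infer_instance
  have : (Ideal.span {π}).LiesOver 𝓂[K] := by
    have hmem : IsLocalRing.maximalIdeal (maxOrder K L) ∈ 𝓂[K].primesOver (maxOrder K L) := by
      rw [IsLocalRing.primesOver_eq (maxOrder K L) hp0]; rfl
    rw [← hπ.maximalIdeal_eq]
    exact hmem.2
  have hspec : Ideal.ramificationIdx' 𝓂[K] (Ideal.span {π}) = e := by
    have hmap : Ideal.map (algebraMap 𝒪[K] (maxOrder K L)) 𝓂[K] = Ideal.span {π ^ e} := by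
      rw [hp.maximalIdeal_eq, Ideal.map_span, Set.image_singleton, hw,
        Ideal.span_singleton_mul_left_unit w.isUnit]
    refine Ideal.ramificationIdx'_spec ?_ ?_
    · rw [hmap, Ideal.span_singleton_pow]
    · rw [hmap, Ideal.span_singleton_pow, Ideal.span_singleton_le_span_singleton,
        pow_dvd_pow_iff hπ.ne_zero hπ.not_isUnit]
      omega
  rw [ramificationDegree, ← Ideal.ramificationIdx'_eq_ramificationIdx 𝓂[K] _ hp0, hspec]
  exact hw

/-- The norm of a uniformizer has valuation `f`: taking norms in `p = w π ^ e` gives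
`2 = e v(N π)`, while `2 = e f`. -/
theorem Coordinates.exists_intNorm_uniformizer_eq [CharZero K] [FiniteDimensional K L]
    [IsDiscreteValuationRing 𝒪[K]] [IsDiscreteValuationRing (maxOrder K L)] (hp : Irreducible p)
    (h : IsGenerator K Δ) (C : Coordinates K Δ) (hL : Module.finrank K L = 2)
    {π : maxOrder K L} (hπ : Irreducible π) :
    ∃ u : 𝒪[K]ˣ, C.intNorm h π = u * p ^ inertiaDegree π := by
  obtain ⟨w, hw⟩ := exists_algebraMap_eq_unit_mul_pow hp hπ
  have hef := ramificationDegree_mul_inertiaDegree hp hπ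
  rw [hL] at hef
  have hne : C.intNorm h π ≠ 0 := fun h0 =>
    C.norm_unit_ne_zero (Units.mk0 (π : L) (by simpa using hπ.ne_zero)) (congrArg Subtype.val h0)
  obtain ⟨d, u, hu⟩ := IsDiscreteValuationRing.eq_unit_mul_pow_irreducible hne hp
  have h1 := congrArg (C.intNorm h) hw
  have h2 : C.intNorm h (algebraMap 𝒪[K] (maxOrder K L) p) = p ^ 2 :=
    Subtype.ext (C.norm_algebraMap p)
  rw [h2, map_mul, map_pow, hu] at h1
  have h3 : C.intNorm h w * (u * p ^ d) ^ ramificationDegree π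
      = (Units.map (C.intNorm h) w * u ^ ramificationDegree π : 𝒪[K]ˣ)
        * p ^ (d * ramificationDegree π) := by
    push_cast
    rw [mul_pow, pow_mul, mul_assoc]
    rfl
  have h4 := congrArg (emultiplicity p) h1
  rw [h3, emultiplicity_units_mul_pow hp, emultiplicity_pow_self hp.ne_zero hp.not_isUnit] at h4
  have h5 : 2 = d * ramificationDegree π := by exact_mod_cast h4
  have h6 : d = inertiaDegree π := by
    have he : 0 < ramificationDegree π := Nat.pos_of_ne_zero fun h0 => by simp [h0] at h5
    refine Nat.eq_of_mul_eq_mul_left he ?_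
    rw [hef, h5, mul_comm]
  exact ⟨u, h6 ▸ hu⟩

theorem contributionNonsplit_typeNonsplit [CharZero K] [FiniteDimensional K L]
    [IsDiscreteValuationRing 𝒪[K]] [IsDiscreteValuationRing (maxOrder K L)] (hp : Irreducible p)
    (h : IsGenerator K Δ) (C : Coordinates K Δ) (hL : Module.finrank K L = 2)
    {π : maxOrder K L} (hπ : Irreducible π) (a : maxOrder K L) (u : 𝒪[K]ˣ) (d : ℕ)
    (ha : C.norm (a : L) = (u * p ^ d : 𝒪[K])) :
    contributionNonsplit π (typeNonsplit π a) = d := by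
  have ha' : C.intNorm h a = u * p ^ d := Subtype.ext ha
  have ha0 : a ≠ 0 := by
    rintro rfl
    have h0 : C.norm ((0 : maxOrder K L) : L) = 0 := by
      have := C.norm_algebraMap 0
      rw [map_zero] at this
      simpa using this
    rw [h0] at ha
    exact mul_ne_zero u.ne_zero (pow_ne_zero d hp.ne_zero) (Subtype.ext ha.symm)
  obtain ⟨k, w, rfl⟩ := IsDiscreteValuationRing.eq_unit_mul_pow_irreducible ha0 hπ
  obtain ⟨s, hs⟩ := C.exists_intNorm_uniformizer_eq hp h hL hπ
  rw [map_mul, map_pow, hs] at ha'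
  have h3 : C.intNorm h w * (s * p ^ inertiaDegree π) ^ k
      = (Units.map (C.intNorm h) w * s ^ k : 𝒪[K]ˣ) * p ^ (inertiaDegree π * k) := by
    push_cast
    rw [mul_pow, pow_mul, mul_assoc]
    rfl
  have h4 := congrArg (emultiplicity p) ha'
  rw [h3, emultiplicity_units_mul_pow hp, emultiplicity_units_mul_pow hp] at h4
  rw [contributionNonsplit, typeNonsplit, emultiplicity_units_mul_pow hπ, ← h4]
  push_cast
  rfl

theorem typeNonsplit_mono {π a b : maxOrder K L} (hab : a ∣ b) :
    typeNonsplit π a ≤ typeNonsplit π b :=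
  emultiplicity_le_emultiplicity_of_dvd_right hab

/-- Every invertible element of `L` is a unit of `O_L` times a power of the uniformizer, up to
scalars. -/
theorem exists_eq_smul_uniformizer_pow [FiniteDimensional K L] [IsDiscreteValuationRing 𝒪[K]]
    [IsDiscreteValuationRing (maxOrder K L)] {π : maxOrder K L} (hπ : Irreducible π) (a : Lˣ) :
    ∃ (c : Kˣ) (k : ℕ) (w : (maxOrder K L)ˣ),
      (a : L) = (c : K) • ((π : L) ^ k * ((w : maxOrder K L) : L)) := by
  have hx : IsAlgebraic 𝒪[K] (a : L) :=
    (IsFractionRing.isAlgebraic_iff 𝒪[K] K L).2 (Algebra.IsIntegral.isIntegral (a : L)).isAlgebraic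
  obtain ⟨r, hr, hrx⟩ := hx.exists_integral_multiple
  have hrK : (r : K) ≠ 0 := by simpa using hr
  have hra : (r : K) • (a : L) ≠ 0 := smul_ne_zero hrK a.ne_zero
  obtain ⟨k, w, hw⟩ := IsDiscreteValuationRing.eq_unit_mul_pow_irreducible
    (x := (⟨r • (a : L), hrx⟩ : maxOrder K L)) (fun h0 => hra (congrArg Subtype.val h0)) hπ
  refine ⟨(Units.mk0 (r : K) hrK)⁻¹, k, w, ?_⟩
  have hw' : (r : K) • (a : L) = ((w : maxOrder K L) : L) * (π : L) ^ k := congrArg Subtype.val hw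
  rw [mul_comm, ← hw', Units.val_inv_eq_inv_val, Units.val_mk0, inv_smul_smul₀ hrK]

theorem exists_uniformizer_pow_eq_smul [CharZero K] [FiniteDimensional K L]
    [IsDiscreteValuationRing 𝒪[K]] [IsDiscreteValuationRing (maxOrder K L)] (hp : Irreducible p)
    {π : maxOrder K L} (hπ : Irreducible π) :
    ∃ v : (maxOrder K L)ˣ,
      (π : L) ^ ramificationDegree π = (p : K) • ((v : maxOrder K L) : L) := by
  obtain ⟨v, hv⟩ := exists_algebraMap_eq_unit_mul_pow hp hπ
  refine ⟨v⁻¹, ?_⟩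
  have h1 : π ^ ramificationDegree π = ↑v⁻¹ * algebraMap 𝒪[K] (maxOrder K L) p := by
    rw [hv, Units.inv_mul_cancel_left]
  have h2 : (π : L) ^ ramificationDegree π
      = (((v⁻¹ : (maxOrder K L)ˣ) : maxOrder K L) : L) * algebraMap K L p :=
    congrArg Subtype.val h1
  rw [h2, Algebra.smul_def, mul_comm]

theorem mem_unramifiedBasin_iff [CharZero K] [FiniteDimensional K L]
    [IsDiscreteValuationRing 𝒪[K]] [IsDiscreteValuationRing (maxOrder K L)] (hp : Irreducible p)
    (h : IsGenerator K Δ) {π : maxOrder K L} (hπ : Irreducible π) (he : ramificationDegree π = 1)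
    (x : Vertex K L) :
    x ∈ unramifiedBasin hp h ↔ ∃ a : Lˣ, x = ((orderLattice hp h 0).mul a).toVertex := by
  constructor
  · rintro rfl
    exact ⟨1, by rw [Lattice.mul_one]⟩
  · rintro ⟨a, rfl⟩
    obtain ⟨c, k, w, hw⟩ := exists_eq_smul_uniformizer_pow hπ a
    obtain ⟨v, hπp⟩ := exists_uniformizer_pow_eq_smul hp hπ
    rw [he, pow_one] at hπp
    have hp0 := coe_ne_zero_of_irreducible hp
    refine (toVertex_mul_orderLattice_zero_eq hp h (b := 1) (c * Units.mk0 (p : K) hp0 ^ k)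
      (v ^ k * w) ?_).trans (by rw [Lattice.mul_one])
    rw [hw, hπp, smul_pow, smul_mul_assoc, ← mul_smul]
    push_cast
    simp

theorem mem_ramifiedBasin_iff [CharZero K] [FiniteDimensional K L] [IsDiscreteValuationRing 𝒪[K]]
    [IsDiscreteValuationRing (maxOrder K L)] (hp : Irreducible p) (h : IsGenerator K Δ)
    (hL : Module.finrank K L = 2)
    {π : maxOrder K L} (hπ : Irreducible π) (he : ramificationDegree π ≠ 1) (x : Vertex K L) :
    x ∈ ramifiedBasin hp h hπ ↔ ∃ a : Lˣ, x = ((orderLattice hp h 0).mul a).toVertex := by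
  constructor
  · rintro (rfl | rfl)
    · exact ⟨1, by rw [Lattice.mul_one]⟩
    · exact ⟨_, rfl⟩
  · rintro ⟨a, rfl⟩
    have he2 : ramificationDegree π = 2 := by
      have hef := ramificationDegree_mul_inertiaDegree hp hπ
      rw [hL] at hef
      exact ((Nat.dvd_prime Nat.prime_two).1 ⟨_, hef.symm⟩).resolve_left he
    obtain ⟨c, k, w, hw⟩ := exists_eq_smul_uniformizer_pow hπ a
    obtain ⟨v, hπp⟩ := exists_uniformizer_pow_eq_smul hp hπ
    rw [he2] at hπp
    have hp0 := coe_ne_zero_of_irreducible hp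
    -- the parity of the valuation of `a` decides between the two vertices
    rcases Nat.even_or_odd' k with ⟨m, rfl | rfl⟩
    · refine Or.inl ?_
      refine (toVertex_mul_orderLattice_zero_eq hp h (b := 1) (c * Units.mk0 (p : K) hp0 ^ m)
        (v ^ m * w) ?_).trans (by rw [Lattice.mul_one])
      rw [hw, pow_mul, hπp, smul_pow, smul_mul_assoc, ← mul_smul]
      push_cast
      simp
    · refine Or.inr ?_
      refine toVertex_mul_orderLattice_zero_eq hp h (c * Units.mk0 (p : K) hp0 ^ m)
        (v ^ m * w) ?_
      rw [hw, pow_succ, pow_mul, hπp, smul_pow, smul_mul_assoc, smul_mul_assoc, ← mul_smul]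
      push_cast
      simp only [Units.val_mk0]
      ring_nf

end Ramification

/-- The instance for adically complete rings, for the uniform structure that the topology of `K`
determines. -/
theorem henselianRing_integers (K : Type u) [Field K] [ValuativeRel K] [TopologicalSpace K]
    [IsNonarchimedeanLocalField K] : HenselianRing 𝒪[K] 𝓂[K] := by
  let _ := IsTopologicalAddGroup.rightUniformSpace K
  have := isUniformAddGroup_of_addCommGroup (G := K)
  infer_instance

end ImpactedBuilding

end

theorem mainTheorem4 (K : Type u) [Field K] [ValuativeRel K] [TopologicalSpace K]
    [IsNonarchimedeanLocalField K] [CharZero K] (p : 𝒪[K]) (hp : Irreducible p) (n : ℕ) :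
    (∀ (L : Type v) [Field L] [Algebra K L] [FiniteDimensional K L],
      Module.finrank K L = 2 →
      ∀ (π : ImpactedBuilding.maxOrder K L) (hπ : Irreducible π)
        (Δ : L) (h : ImpactedBuilding.IsGenerator K Δ),
        (ImpactedBuilding.ramificationDegree π = 1 →
          ∀ x ∈ ImpactedBuilding.layer (ImpactedBuilding.unramifiedBasin hp h) n,
            ∃ ω : ℕ∞, ImpactedBuilding.IsSource (ImpactedBuilding.typeNonsplit π) p h n x ω ∧
              (ImpactedBuilding.tree K L).edist x
                  (ImpactedBuilding.orderLattice hp h n).toVertex =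
                ImpactedBuilding.contributionNonsplit π ω) ∧
        (ImpactedBuilding.ramificationDegree π ≠ 1 →
          ∀ x ∈ ImpactedBuilding.layer (ImpactedBuilding.ramifiedBasin hp h hπ) n,
            ∃ ω : ℕ∞, ImpactedBuilding.IsSource (ImpactedBuilding.typeNonsplit π) p h n x ω ∧
              (ImpactedBuilding.tree K L).edist x
                  (ImpactedBuilding.orderLattice hp h n).toVertex =
                ImpactedBuilding.contributionNonsplit π ω)) ∧
    (∀ (Δ : K × K) (h : ImpactedBuilding.IsGenerator K Δ),
      ∀ x ∈ ImpactedBuilding.layer (ImpactedBuilding.splitBasin hp h) n,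
        ∃ ω : ℕ∞ × ℕ∞, ImpactedBuilding.IsSource (ImpactedBuilding.typeSplit p) p h n x ω ∧
          (ImpactedBuilding.tree K (K × K)).edist x
              (ImpactedBuilding.orderLattice hp h n).toVertex =
            ImpactedBuilding.contributionSplit ω) := by
  open ImpactedBuilding in
  refine ⟨fun L _ _ _ hL π hπ Δ h => ?_, fun Δ h x hx => ?_⟩
  · obtain ⟨C⟩ := h.nonempty_coordinates hL
    have := henselianRing_integers K
    have := isLocalRing_maxOrder C h
    have := isDiscreteValuationRing_maxOrder hπ
    have hc := contributionNonsplit_typeNonsplit hp h C hL hπ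
    exact ⟨fun he x hx => exists_isSource_of_mem_layer hp h C
        (mem_unramifiedBasin_iff hp h hπ he) _ _ (fun _ _ => typeNonsplit_mono) hc hx,
      fun he x hx => exists_isSource_of_mem_layer hp h C
        (mem_ramifiedBasin_iff hp h hL hπ he) _ _ (fun _ _ => typeNonsplit_mono) hc hx⟩
  · obtain ⟨C⟩ := h.nonempty_coordinates (by simp)
    exact exists_isSource_of_mem_layer hp h C (mem_splitBasin_iff hp h) _ _
      (fun _ _ => typeSplit_mono p) (contributionSplit_typeSplit hp C) hx
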